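/- Notation. For an $m\times m$ real matrix $M$, $s_1(M)\ge s_2(M)\ge\dots\ge s_m(M)$ are its singular values with multiplicity; for $M$ with nonnegative entries, $u(M),v(M)\in\mathbb{R}_+^m$ are the vectors of its column sums and of its row sums, respectively. For $m\in\mathbb{N}$ and $d,\delta>0$ let $\mathrm{Deg}_m(d,\delta)$ be the set of all pairs $(u,v)\in\mathbb{R}_+^m\times\mathbb{R}_+^m$ such that $\|u\|_1=\|v\|_1$ and, for all $k\in\mathbb{N}$, $$\big|\{i\le m:\ |u_i-d|>k\delta\}\big|\le m e^{-k^2}\quad\text{and}\quad \big|\{i\le m:\ |v_i-d|>k\delta\}\big|\le m e^{-k^2}.$$ A random $n\times n$ matrix $A=(A_{ij})$ is jointly exchangeable if it has the same distribution as $(A_{\sigma(i)\sigma(j)})_{i,j=1}^n$ for every non-random permutation $\sigma$ of $\{1,\dots,n\}$. Theorem. There exist positive universal constants $c,C$ such that the following holds. Let $n\ge C$ be an integer and let $d,\delta>0$ satisfy $d/\sqrt{\ln n}\ge C\delta$. Let $A$ be a jointly exchangeable random $n\times n$ matrix which almost surely has nonnegative entries and all of whose row sums and column sums are equal to $d$,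 and suppose that almost surely $$C\|\mathrm{row}_i(A)\|_2\le\delta\quad\text{and}\quad C\|\mathrm{col}_i(A)\|_2\le\delta\qquad\text{for all } i\le n.$$ Let $T$ be the top right $\lfloor n/2\rfloor\times\lfloor n/2\rfloor$ corner of $A$ (first $\lfloor n/2\rfloor$ rows, last $\lfloor n/2\rfloor$ columns). Then for every $L\ge C$, $$\mathbb{P}\{s_2(A)\ge L\delta\}\le\frac1c\,\mathbb{P}\Big\{s_2(T)\ge cL\delta\ \text{ and }\ \big(u(T),v(T)\big)\in\mathrm{Deg}_{\lfloor n/2\rfloor}(d/2,\delta)\Big\}.$$ -/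

import Mathlib

open MeasureTheory ProbabilityTheory

namespace JointExch

/-- Matrices carry the product `σ`-algebra of their entries. -/
instance instMeasurableSpaceMatrix {m n : ℕ} : MeasurableSpace (Matrix (Fin m) (Fin n) ℝ) :=
  inferInstanceAs (MeasurableSpace (Fin m → Fin n → ℝ))

/-- `σ(M)`, the matrix whose `(i, j)`-th entry is `M (σ i) (σ j)`. -/
def permute {n : ℕ} (σ : Equiv.Perm (Fin n)) (M : Matrix (Fin n) (Fin n) ℝ) :
    Matrix (Fin n) (Fin n) ℝ :=
  M.submatrix σ σ

/-- A random matrix `A` is jointly exchangeable if `A` and `σ(A)` have the same law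
for every non-random permutation `σ`. -/
def JointlyExchangeable {Ω : Type*} [MeasurableSpace Ω] (P : Measure Ω) {n : ℕ}
    (A : Ω → Matrix (Fin n) (Fin n) ℝ) : Prop :=
  ∀ σ : Equiv.Perm (Fin n), IdentDistrib A (fun ω => permute σ (A ω)) P P

/-- The vector `u(A)` of the `ℓ₁`-norms of the columns of `A`. -/
noncomputable def colNorms {m : ℕ} (A : Matrix (Fin m) (Fin m) ℝ) : Fin m → ℝ :=
  fun j => ‖WithLp.toLp 1 (A.col j)‖

/-- The vector `v(A)` of the `ℓ₁`-norms of the rows of `A`. -/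
noncomputable def rowNorms {m : ℕ} (A : Matrix (Fin m) (Fin m) ℝ) : Fin m → ℝ :=
  fun i => ‖WithLp.toLp 1 (A.row i)‖

/-- The set `𝒜_m(u, v)` of the matrices with nonnegative entries, vector of column sums `u` and
vector of row sums `v`. -/
def matrixClass {m : ℕ} (u v : Fin m → ℝ) : Set (Matrix (Fin m) (Fin m) ℝ) :=
  {A | (∀ i j, 0 ≤ A i j) ∧ colNorms A = u ∧ rowNorms A = v}

/-- The set `𝒜_m(d)` of the nonnegative matrices all of whose row and column sums equal `d`. -/
def regularClass (m : ℕ) (d : ℝ) : Set (Matrix (Fin m) (Fin m) ℝ) :=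
  matrixClass (fun _ => d) (fun _ => d)

/-- The second largest singular value (counting multiplicities), i.e. the singular value of index
`1` of the associated operator between Euclidean spaces, indices starting from `0`. -/
noncomputable def s₂ {m : ℕ} (A : Matrix (Fin m) (Fin m) ℝ) : ℝ :=
  (Matrix.toEuclideanLin A).singularValues 1

/-- The top right `⌊n/2⌋ × ⌊n/2⌋` corner: the first `⌊n/2⌋` rows and last `⌊n/2⌋` columns. -/
def topRight {n : ℕ} (A : Matrix (Fin n) (Fin n) ℝ) : Matrix (Fin (n / 2)) (Fin (n / 2)) ℝ :=
  Matrix.of fun i j => A ⟨i, by omega⟩ ⟨n - n / 2 + j, by omega⟩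

/-- The set `Deg_m(d, δ)` of pairs of almost constant degree vectors. -/
def Deg (m : ℕ) (d δ : ℝ) : Set ((Fin m → ℝ) × (Fin m → ℝ)) :=
  {p | (∀ i, 0 ≤ p.1 i) ∧ (∀ i, 0 ≤ p.2 i) ∧
    ‖WithLp.toLp 1 p.1‖ = ‖WithLp.toLp 1 p.2‖ ∧
    (∀ k : ℕ, ((Finset.univ.filter fun i => (k : ℝ) * δ < |p.1 i - d|).card : ℝ)
      ≤ m * Real.exp (-(k : ℝ) ^ 2)) ∧
    (∀ k : ℕ, ((Finset.univ.filter fun i => (k : ℝ) * δ < |p.2 i - d|).card : ℝ)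
      ≤ m * Real.exp (-(k : ℝ) ^ 2))}

end JointExch

/-! By joint exchangeability, relabelling `A` by a uniform random permutation `σ` does not change
its law. So it suffices to fix one regular matrix `A` with `s₂ A ≥ Lδ` and show that a proportion at
least 1/64 of all `σ` puts `permute σ A` in `cornerEvent` (`le_expect_cornerEvent`). Integrating
over the probability space then gives the theorem with `c = 1/64`
(`measureReal_le_of_expect_indicator`).

For fixed `A`, let `x`, `y` maximize the bilinear form of `A` over the unit balls of the zero-sum
vectors, with maximum `s`. Since `A` preserves the zero-sum vectors, `s ≥ s₂ A`. Let `Z` be the part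
of the form at `(x, y)` seen by the corner of the relabelled matrix. Corner rows and columns have
disjoint labels, so the mean of `Z` is about `s/4`. Maximality bounds every `Z` by `s` plus a small
multiple of the product of the sums of the restricted vectors (`bilinear_submatrix_le`). A variable
with mean near `s/4` and essentially bounded by `s` is at least `s/8` with probability bounded
below.

Two side conditions must hold simultaneously. The restricted vectors must have bounded sums, which
follows from a second moment (`expect_sq_sum_perm_le`). The degrees of the corner must be
concentrated, which follows from exponential moments obtained by random swaps of row labels with
column labels (`expect_exp_sum_perm_le`) and summarized by the functional `expDev`. Under these
conditions the corner acts on the constants with size about `d/2`, and the restricted vectors are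
almost decoupled from this direction, so Courant-Fischer yields a second singular value at least
`s/64` (`le_s₂_of_bilinear`). -/

namespace JointExch

/-! ### Courant-Fischer for the second singular value, and its continuity. -/

section SingularValues

variable {E F : Type*} [NormedAddCommGroup E] [InnerProductSpace ℝ E] [FiniteDimensional ℝ E]
  [NormedAddCommGroup F] [InnerProductSpace ℝ F] [FiniteDimensional ℝ F]

theorem norm_sq_apply_eq_sum (T : E →ₗ[ℝ] F) {N : ℕ} (hN : Module.finrank ℝ E = N) (z : E) :
    ‖T z‖ ^ 2 = ∑ i : Fin N, T.singularValues i ^ 2 *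
      inner ℝ (T.isSymmetric_adjoint_comp_self.eigenvectorBasis hN i) z ^ 2 := by
  set b := T.isSymmetric_adjoint_comp_self.eigenvectorBasis hN
  have h1 : ‖T z‖ ^ 2 = inner ℝ ((LinearMap.adjoint T ∘ₗ T) z) z := by
    rw [LinearMap.comp_apply, LinearMap.adjoint_inner_left, real_inner_self_eq_norm_sq]
  rw [h1, ← b.sum_inner_mul_inner]
  refine Finset.sum_congr rfl fun i _ => ?_
  have h2 := T.isSymmetric_adjoint_comp_self.eigenvectorBasis_apply_self_apply hN z i
  rw [OrthonormalBasis.repr_apply_apply, OrthonormalBasis.repr_apply_apply] at h2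
  rw [real_inner_comm, h2, T.sq_singularValues_fin hN]
  simp only [RCLike.ofReal_real_eq_id, id]
  ring

theorem norm_sq_eq_sum_inner_eigenvectorBasis (T : E →ₗ[ℝ] F) {N : ℕ}
    (hN : Module.finrank ℝ E = N) (z : E) :
    ‖z‖ ^ 2 = ∑ i : Fin N,
      inner ℝ (T.isSymmetric_adjoint_comp_self.eigenvectorBasis hN i) z ^ 2 := by
  set b := T.isSymmetric_adjoint_comp_self.eigenvectorBasis hN
  rw [← real_inner_self_eq_norm_sq, ← b.sum_inner_mul_inner]
  refine Finset.sum_congr rfl fun i _ => ?_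
  rw [real_inner_comm]
  ring

/-- The lower half of the Courant-Fischer principle for the second singular value. -/
theorem exists_submodule_singularValue_one_mul_norm_le (T : E →ₗ[ℝ] F)
    (hE : 1 < Module.finrank ℝ E) :
    ∃ V : Submodule ℝ E, Module.finrank ℝ V = 2 ∧
      ∀ z ∈ V, T.singularValues 1 * ‖z‖ ≤ ‖T z‖ := by
  set b := T.isSymmetric_adjoint_comp_self.eigenvectorBasis rfl with hb
  let g : Fin 2 → Fin (Module.finrank ℝ E) := fun i => ⟨i, by omega⟩
  have hg : Function.Injective g := fun i j h => Fin.ext (by simpa [g] using h)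
  refine ⟨Submodule.span ℝ (Set.range (b ∘ g)), ?_, fun z hz => ?_⟩
  · rw [finrank_span_eq_card ((b.orthonormal.comp g hg).linearIndependent)]
    simp
  have h0 : ∀ j : Fin (Module.finrank ℝ E), 1 < (j : ℕ) → inner ℝ (b j) z = 0 := by
    intro j hj
    induction hz using Submodule.span_induction with
    | mem x hx =>
      obtain ⟨i, rfl⟩ := hx
      refine b.orthonormal.2 fun h => ?_
      rw [h] at hj
      simp only [g] at hj
      omega
    | zero => simp
    | add x y _ _ hx hy => rw [inner_add_right, hx, hy, add_zero]
    | smul a x _ hx => rw [inner_smul_right, hx, mul_zero]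
  refine le_of_sq_le_sq ?_ (norm_nonneg _)
  rw [mul_pow, norm_sq_apply_eq_sum T rfl, norm_sq_eq_sum_inner_eigenvectorBasis T rfl,
    Finset.mul_sum]
  refine Finset.sum_le_sum fun j _ => ?_
  by_cases hj : 1 < (j : ℕ)
  · rw [← hb, h0 j hj]
    simp
  · have := T.singularValues_antitone (not_lt.1 hj)
    have h2 := T.singularValues_nonneg 1
    gcongr

/-- The upper half of the Courant-Fischer principle for the second singular value. -/
theorem exists_functional_norm_le_singularValue_one_mul (T : E →ₗ[ℝ] F)
    (hE : 1 < Module.finrank ℝ E) :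
    ∃ φ : E →ₗ[ℝ] ℝ, ∀ z, φ z = 0 → ‖T z‖ ≤ T.singularValues 1 * ‖z‖ := by
  set b := T.isSymmetric_adjoint_comp_self.eigenvectorBasis rfl with hb
  refine ⟨(innerₛₗ ℝ (b ⟨0, by omega⟩)), fun z hz => ?_⟩
  replace hz : inner ℝ (b ⟨0, by omega⟩) z = 0 := hz
  refine le_of_sq_le_sq ?_ (mul_nonneg (T.singularValues_nonneg 1) (norm_nonneg _))
  rw [mul_pow, norm_sq_apply_eq_sum T rfl, norm_sq_eq_sum_inner_eigenvectorBasis T rfl,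
    Finset.mul_sum]
  refine Finset.sum_le_sum fun j _ => ?_
  by_cases hj : (j : ℕ) = 0
  · rw [← hb, show j = ⟨0, by omega⟩ from Fin.ext hj, hz]
    simp
  · have := T.singularValues_antitone (show 1 ≤ (j : ℕ) by omega)
    have h2 := T.singularValues_nonneg (j : ℕ)
    gcongr

theorem exists_mem_ne_zero_of_finrank_eq_two {V : Submodule ℝ E} (hV : Module.finrank ℝ V = 2)
    (φ : E →ₗ[ℝ] ℝ) : ∃ z ∈ V, z ≠ 0 ∧ φ z = 0 := by
  have h := LinearMap.ker_ne_bot_of_finrank_lt (f := φ.comp V.subtype) (by simp [hV])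
  obtain ⟨z, hz, hz0⟩ := Submodule.exists_mem_ne_zero_of_ne_bot h
  exact ⟨z, z.2, by simpa using hz0, by simpa using hz⟩

/-- A plane on which `S` expands by its second singular value meets the hyperplane on which `T` is
bounded by its own; a common nonzero vector compares the two. This Weyl inequality gives continuity,
hence measurability, of `s₂`. -/
theorem singularValue_one_le_add (S T : E →ₗ[ℝ] F) (hE : 1 < Module.finrank ℝ E) :
    S.singularValues 1 ≤ T.singularValues 1 + ‖LinearMap.toContinuousLinearMap (S - T)‖ := by
  obtain ⟨V, hV, hS⟩ := exists_submodule_singularValue_one_mul_norm_le S hE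
  obtain ⟨φ, hT⟩ := exists_functional_norm_le_singularValue_one_mul T hE
  obtain ⟨z, hzV, hz0, hz⟩ := exists_mem_ne_zero_of_finrank_eq_two hV φ
  have h1 := hS z hzV
  have h2 := hT z hz
  have h3 := (LinearMap.toContinuousLinearMap (S - T)).le_opNorm z
  have h4 : S z = T z + LinearMap.toContinuousLinearMap (S - T) z := by simp
  have h5 := norm_add_le (T z) (LinearMap.toContinuousLinearMap (S - T) z)
  rw [← h4] at h5
  refine le_of_mul_le_mul_right ?_ (norm_pos_iff.2 hz0)
  linarith

end SingularValues

theorem continuous_s₂ {m : ℕ} (hm : 1 < m) :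
    Continuous (s₂ : Matrix (Fin m) (Fin m) ℝ → ℝ) := by
  have hE : 1 < Module.finrank ℝ (EuclideanSpace ℝ (Fin m)) := by simpa using hm
  let Φ : Matrix (Fin m) (Fin m) ℝ →ₗ[ℝ]
      (EuclideanSpace ℝ (Fin m) →L[ℝ] EuclideanSpace ℝ (Fin m)) :=
    LinearMap.toContinuousLinearMap.toLinearMap ∘ₗ Matrix.toEuclideanLin.toLinearMap
  have hΦ : Continuous Φ := Φ.continuous_of_finiteDimensional
  have hle : ∀ M N : Matrix (Fin m) (Fin m) ℝ, s₂ M ≤ s₂ N + ‖Φ M - Φ N‖ := by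
    intro M N
    have := singularValue_one_le_add (Matrix.toEuclideanLin M) (Matrix.toEuclideanLin N) hE
    rw [← map_sub] at this
    rw [← map_sub Φ]
    exact this
  rw [continuous_iff_continuousAt]
  intro N
  rw [ContinuousAt, tendsto_iff_norm_sub_tendsto_zero]
  have h0 : Filter.Tendsto (fun M => ‖Φ M - Φ N‖) (nhds N) (nhds 0) :=
    tendsto_iff_norm_sub_tendsto_zero.1 hΦ.continuousAt
  refine squeeze_zero (fun _ => norm_nonneg _) (fun M => ?_) h0
  rw [Real.norm_eq_abs, abs_le]
  have h1 := hle M N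
  have h2 := hle N M
  rw [norm_sub_rev] at h2
  constructor <;> linarith

/-! ### Moments of statistics of a uniform random permutation. -/

section Permutations

variable {n : ℕ}

theorem exists_perm_apply_eq {ι : Type*} {α β : ι → Fin n} (hα : Function.Injective α)
    (hβ : Function.Injective β) : ∃ σ : Equiv.Perm (Fin n), ∀ i, σ (α i) = β i := by
  let e : {x // x ∈ Set.range α} ≃ {x // x ∈ Set.range β} :=
    (Equiv.ofInjective α hα).symm.trans (Equiv.ofInjective β hβ)
  classical
  refine ⟨e.extendSubtype, fun i => ?_⟩
  rw [e.extendSubtype_apply_of_mem (α i) ⟨i, rfl⟩]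
  have : (Equiv.ofInjective α hα).symm ⟨α i, ⟨i, rfl⟩⟩ = i :=
    Equiv.ofInjective_symm_apply hα i
  simp only [e, Equiv.trans_apply, this, Equiv.ofInjective_apply]

theorem expect_perm_mul_right (τ : Equiv.Perm (Fin n)) (g : Equiv.Perm (Fin n) → ℝ) :
    Finset.expect Finset.univ (fun σ => g (σ * τ)) = Finset.expect Finset.univ g :=
  Fintype.expect_equiv (Equiv.mulRight τ) _ _ fun _ => rfl

theorem expect_perm_apply (i : Fin n) (g : Fin n → ℝ) :
    Finset.expect Finset.univ (fun σ : Equiv.Perm (Fin n) => g (σ i)) = (∑ a, g a) / n := by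
  have h : ∀ a : Fin n, Finset.expect Finset.univ (fun σ : Equiv.Perm (Fin n) => g (σ a)) =
      Finset.expect Finset.univ (fun σ : Equiv.Perm (Fin n) => g (σ i)) := by
    intro a
    rw [← expect_perm_mul_right (Equiv.swap i a)]
    simp
  have hn : (n : ℝ) ≠ 0 := by
    have := i.pos
    positivity
  rw [eq_div_iff hn]
  calc _ = ∑ a : Fin n, Finset.expect Finset.univ (fun σ : Equiv.Perm (Fin n) => g (σ a)) := by
        simp [h, mul_comm]
    _ = Finset.expect Finset.univ (fun σ : Equiv.Perm (Fin n) => ∑ a, g (σ a)) :=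
        (Finset.expect_sum_comm _ _ _).symm
    _ = _ := by simp [Equiv.sum_comp]

theorem expect_perm_apply_apply {i j : Fin n} (hij : i ≠ j) (g : Fin n → Fin n → ℝ) :
    Finset.expect Finset.univ (fun σ : Equiv.Perm (Fin n) => g (σ i) (σ j)) =
      (∑ a, ∑ b, g a b - ∑ a, g a a) / (n * (n - 1)) := by
  set E := Finset.expect Finset.univ (fun σ : Equiv.Perm (Fin n) => g (σ i) (σ j)) with hE
  have h : ∀ a b : Fin n, a ≠ b →
      Finset.expect Finset.univ (fun σ : Equiv.Perm (Fin n) => g (σ a) (σ b)) = E := by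
    intro a b hab
    obtain ⟨τ, hτ⟩ := exists_perm_apply_eq (α := ![i, j]) (β := ![a, b])
      (by intro x y; fin_cases x <;> fin_cases y <;> simp [hij, hij.symm])
      (by intro x y; fin_cases x <;> fin_cases y <;> simp [hab, hab.symm])
    have h0 : τ i = a := hτ 0
    have h1 : τ j = b := hτ 1
    rw [hE, ← expect_perm_mul_right τ (fun σ => g (σ i) (σ j))]
    simp [h0, h1]
  have hn : (2 : ℝ) ≤ n := by
    have h1 := i.isLt
    have h2 := j.isLt
    have h3 : (i : ℕ) ≠ j := fun h => hij (Fin.ext h)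
    have : 2 ≤ n := by omega
    exact_mod_cast this
  have hn' : (n : ℝ) * (n - 1) ≠ 0 := by
    have : (0 : ℝ) < n * (n - 1) := by apply mul_pos <;> linarith
    exact this.ne'
  rw [eq_div_iff hn']
  have hsum : ∑ a : Fin n, ∑ b : Fin n,
      Finset.expect Finset.univ (fun σ : Equiv.Perm (Fin n) => g (σ a) (σ b)) =
      ∑ a : Fin n, ∑ b : Fin n, g a b := by
    calc _ = Finset.expect Finset.univ
          (fun σ : Equiv.Perm (Fin n) => ∑ a, ∑ b, g (σ a) (σ b)) := by
          rw [Finset.expect_sum_comm]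
          exact Finset.sum_congr rfl fun a _ => (Finset.expect_sum_comm _ _ _).symm
      _ = Finset.expect Finset.univ
          (fun _ : Equiv.Perm (Fin n) => ∑ a, ∑ b, g a b) := by
          refine Finset.expect_congr rfl fun σ _ => ?_
          rw [← Equiv.sum_comp σ (fun a => ∑ b, g a b)]
          exact Finset.sum_congr rfl fun a _ => Equiv.sum_comp σ (fun b => g (σ a) b)
      _ = _ := by simp
  have hdiag : ∑ a : Fin n,
      Finset.expect Finset.univ (fun σ : Equiv.Perm (Fin n) => g (σ a) (σ a)) =
      ∑ a : Fin n, g a a := by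
    calc _ = Finset.expect Finset.univ (fun σ : Equiv.Perm (Fin n) => ∑ a, g (σ a) (σ a)) :=
          (Finset.expect_sum_comm _ _ _).symm
      _ = Finset.expect Finset.univ (fun _ : Equiv.Perm (Fin n) => ∑ a, g a a) :=
          Finset.expect_congr rfl fun σ _ => Equiv.sum_comp σ (fun a => g a a)
      _ = _ := by simp
  rw [← hsum, ← hdiag, ← Finset.sum_sub_distrib]
  have hrow : ∀ a : Fin n, ∑ b : Fin n,
      Finset.expect Finset.univ (fun σ : Equiv.Perm (Fin n) => g (σ a) (σ b)) -
      Finset.expect Finset.univ (fun σ : Equiv.Perm (Fin n) => g (σ a) (σ a)) =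
      (n - 1) * E := by
    intro a
    rw [← Finset.sum_erase_eq_sub (Finset.mem_univ a),
      Finset.sum_congr rfl (fun b hb => h a b (Finset.ne_of_mem_erase hb).symm)]
    have : 1 ≤ n := a.pos
    simp [Finset.card_erase_of_mem, Nat.cast_sub this]
  rw [Finset.sum_congr rfl fun a _ => hrow a]
  simp
  ring

/-- Sampling without replacement from a zero-sum vector gives nonpositively correlated terms, so
only the diagonal of the expanded square contributes. -/
theorem expect_sq_sum_perm_le {m : ℕ} (hmn : m ≤ n) {e : Fin m → Fin n}
    (he : Function.Injective e) (x : Fin n → ℝ) (hx : ∑ i, x i = 0) :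
    Finset.expect Finset.univ (fun σ : Equiv.Perm (Fin n) => (∑ i, x (σ (e i))) ^ 2) ≤
      ∑ i, x i ^ 2 := by
  have hX : 0 ≤ ∑ i, x i ^ 2 := Finset.sum_nonneg fun i _ => sq_nonneg _
  have hterm : ∀ i j : Fin m, Finset.expect Finset.univ
      (fun σ : Equiv.Perm (Fin n) => x (σ (e i)) * x (σ (e j))) ≤
      if i = j then (∑ i, x i ^ 2) / n else 0 := by
    intro i j
    split_ifs with hij
    · subst hij
      rw [expect_perm_apply (e i) (fun a => x a * x a)]
      simp [pow_two]
    · rw [expect_perm_apply_apply (fun h => hij (he h)) (fun a b => x a * x b)]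
      have h0 : ∑ a, ∑ b, x a * x b = 0 := by
        rw [← Finset.sum_mul_sum, hx, zero_mul]
      rw [h0]
      have : 1 ≤ (n : ℝ) := by exact_mod_cast (e i).pos
      apply div_nonpos_of_nonpos_of_nonneg
      · simpa [pow_two] using hX
      · apply mul_nonneg <;> linarith
  calc _ = ∑ i : Fin m, ∑ j : Fin m, Finset.expect Finset.univ
          (fun σ : Equiv.Perm (Fin n) => x (σ (e i)) * x (σ (e j))) := by
        rw [← Finset.sum_congr rfl fun i _ => Finset.expect_sum_comm _ _ _,
          ← Finset.expect_sum_comm]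
        refine Finset.expect_congr rfl fun σ _ => ?_
        rw [pow_two, Finset.sum_mul_sum]
    _ ≤ ∑ i : Fin m, ∑ j : Fin m, if i = j then (∑ i, x i ^ 2) / n else 0 :=
        Finset.sum_le_sum fun i _ => Finset.sum_le_sum fun j _ => hterm i j
    _ = m * ((∑ i, x i ^ 2) / n) := by simp
    _ ≤ _ := by
        rcases Nat.eq_zero_or_pos n with h | h
        · subst h
          simp
        · rw [mul_div_assoc', div_le_iff₀ (by positivity), mul_comm]
          gcongr

theorem expect_sum_sum_perm {m : ℕ} {e f : Fin m → Fin n} (hef : ∀ i j, e i ≠ f j)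
    (g : Fin n → Fin n → ℝ) :
    Finset.expect Finset.univ (fun σ : Equiv.Perm (Fin n) => ∑ i, ∑ j, g (σ (e i)) (σ (f j))) =
      m * m * ((∑ a, ∑ b, g a b - ∑ a, g a a) / (n * (n - 1))) := by
  rw [Finset.expect_sum_comm, Finset.sum_congr rfl fun i _ => Finset.expect_sum_comm _ _ _]
  simp_rw [expect_perm_apply_apply (hef _ _) g]
  simp
  ring

/-- The ranges of `e` and `f` miss at most one index (one exactly when `n` is odd, for the corner);
that index costs at most `κ`. -/
theorem sum_add_sum_le_sum {m : ℕ} {e f : Fin m → Fin n} (he : Function.Injective e)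
    (hf : Function.Injective f) (hef : ∀ i j, e i ≠ f j) (hn : n ≤ 2 * m + 1) {κ : ℝ}
    (g : Fin n → ℝ) (hg : ∀ a, 0 ≤ g a) (hκ0 : 0 ≤ κ) (hκ : ∀ a, g a ≤ κ) :
    ∑ i, (g (e i) + g (f i)) ≤ ∑ a, g a ∧ ∑ a, g a ≤ ∑ i, (g (e i) + g (f i)) + κ := by
  have hinj : Function.Injective (Sum.elim e f) := he.sumElim hf hef
  have h1 : ∑ i, (g (e i) + g (f i)) = ∑ a ∈ Finset.univ.map ⟨Sum.elim e f, hinj⟩, g a := by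
    rw [Finset.sum_map, Finset.sum_add_distrib]
    simp
  have hc : ((Finset.univ.map ⟨Sum.elim e f, hinj⟩)ᶜ).card ≤ 1 := by
    rw [Finset.card_compl, Finset.card_map]
    simp
    omega
  rw [h1, ← Finset.sum_add_sum_compl (Finset.univ.map ⟨Sum.elim e f, hinj⟩) g]
  constructor
  · linarith [Finset.sum_nonneg fun a (_ : a ∈ (Finset.univ.map ⟨Sum.elim e f, hinj⟩)ᶜ) => hg a]
  · have h2 := Finset.sum_le_card_nsmul ((Finset.univ.map ⟨Sum.elim e f, hinj⟩)ᶜ) g κ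
      fun a _ => hκ a
    have h3 : (((Finset.univ.map ⟨Sum.elim e f, hinj⟩)ᶜ).card : ℝ) * κ ≤ 1 * κ := by
      gcongr
      exact_mod_cast hc
    rw [nsmul_eq_mul] at h2
    linarith

/-- Hoeffding's bound for a fair coin between `p` and `q`, from `cosh x ≤ exp (x²/2)`; nonnegativity
gives `(p - q)² ≤ p² + q²`. -/
theorem exp_add_exp_le (t p q : ℝ) (hp : 0 ≤ p) (hq : 0 ≤ q) :
    Real.exp (t * p) + Real.exp (t * q) ≤
      2 * Real.exp (t * (p + q) / 2 + t ^ 2 * (p ^ 2 + q ^ 2) / 8) := by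
  have h := Real.cosh_le_exp_half_sq (t * (p - q) / 2)
  have h1 : Real.exp (t * p) + Real.exp (t * q) =
      2 * (Real.exp (t * (p + q) / 2) * Real.cosh (t * (p - q) / 2)) := by
    rw [Real.cosh_eq, mul_div_assoc', mul_add, ← Real.exp_add, ← Real.exp_add]
    ring_nf
  rw [h1, Real.exp_add]
  have h2 : Real.exp ((t * (p - q) / 2) ^ 2 / 2) ≤ Real.exp (t ^ 2 * (p ^ 2 + q ^ 2) / 8) := by
    apply Real.exp_le_exp.2
    have : t ^ 2 * (p - q) ^ 2 ≤ t ^ 2 * (p ^ 2 + q ^ 2) := by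
      gcongr
      nlinarith
    nlinarith
  gcongr
  exact h.trans h2

/-- Exponential moments of the sum of half of the entries of a column at random positions. -/
theorem expect_exp_sum_perm_le {m : ℕ} {e f : Fin m → Fin n} (he : Function.Injective e)
    (hf : Function.Injective f) (hef : ∀ i j, e i ≠ f j) (hn : n ≤ 2 * m + 1)
    (M : Fin n → Fin n → ℝ) (hM : ∀ a b, 0 ≤ M a b) {d κ : ℝ} (hκ0 : 0 ≤ κ)
    (hcol : ∀ b, ∑ a, M a b = d) (hκ : ∀ b, ∑ a, M a b ^ 2 ≤ κ ^ 2) (j : Fin m) (t : ℝ) :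
    Finset.expect Finset.univ (fun σ : Equiv.Perm (Fin n) =>
      Real.exp (t * (∑ i, M (σ (e i)) (σ (f j)) - d / 2))) ≤
      Real.exp (|t| * κ + t ^ 2 * κ ^ 2 / 8) := by
  -- Coins `ε` decide which of the positions `e i`, `f i` supplies the `i`-th row label. The pair
  -- `j` is frozen because `f j` must keep naming the same column.
  have hτ : ∀ ε : Fin m → Bool, ∃ τ : Equiv.Perm (Fin n),
      (∀ i, τ (e i) = if ε i = true ∧ i ≠ j then f i else e i) ∧ τ (f j) = f j := by
    intro ε
    obtain ⟨τ, h⟩ := exists_perm_apply_eq (α := Sum.elim e (fun _ : Unit => f j))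
      (β := Sum.elim (fun i => if ε i = true ∧ i ≠ j then f i else e i) (fun _ : Unit => f j))
      (he.sumElim (fun _ _ _ => rfl) fun i _ => hef i j) (by
        refine Function.Injective.sumElim ?_ (fun _ _ _ => rfl) ?_
        · intro i i' h
          simp only at h
          split_ifs at h
          · exact hf h
          · exact absurd h.symm (hef _ _)
          · exact absurd h (hef _ _)
          · exact he h
        · intro i _
          split_ifs with hi
          · exact fun h => hi.2 (hf h)
          · exact hef _ _)
    exact ⟨τ, fun i => h (Sum.inl i), h (Sum.inr ())⟩
  choose τ hτe hτf using hτ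
  set G : Equiv.Perm (Fin n) → ℝ := fun σ =>
    Real.exp (t * (∑ i, M (σ (e i)) (σ (f j)) - d / 2)) with hG
  have hsigma : ∀ σ : Equiv.Perm (Fin n), Finset.expect Finset.univ (fun ε => G (σ * τ ε)) ≤
      Real.exp (|t| * κ + t ^ 2 * κ ^ 2 / 8) := by
    intro σ
    set b := σ (f j)
    set p : Fin m → ℝ := fun i => M (σ (e i)) b with hp
    set q : Fin m → ℝ := fun i => M (σ (f i)) b with hq
    have hMκ : ∀ a b, M a b ≤ κ := fun a b => by
      refine le_of_sq_le_sq ((Finset.single_le_sum (f := fun a => M a b ^ 2)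
        (fun a _ => sq_nonneg _) (Finset.mem_univ a)).trans (hκ b)) hκ0
    have hs1 := sum_add_sum_le_sum he hf hef hn (fun a => M (σ a) b) (fun a => hM _ _) hκ0
      (fun a => hMκ _ _)
    have hs2 := (sum_add_sum_le_sum he hf hef hn (fun a => M (σ a) b ^ 2) (fun a => sq_nonneg _)
      (sq_nonneg κ) (fun a => pow_le_pow_left₀ (hM _ _) (hMκ _ _) 2)).1
    rw [Equiv.sum_comp σ (fun a => M a b), hcol] at hs1
    rw [Equiv.sum_comp σ (fun a => M a b ^ 2)] at hs2
    replace hs2 := hs2.trans (hκ b)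
    set h : Fin m → Bool → ℝ := fun i c =>
      Real.exp (t * if c = true ∧ i ≠ j then q i else p i) with hh
    have hG1 : ∀ ε, G (σ * τ ε) = Real.exp (-(t * d / 2)) * ∏ i, h i (ε i) := by
      intro ε
      rw [hh, ← Real.exp_sum, ← Real.exp_add, hG, ← Finset.mul_sum]
      simp only [Equiv.Perm.mul_apply, hτe, hτf]
      congr 1
      rw [mul_sub, sub_eq_neg_add, mul_div_assoc]
      congr 2
      refine Finset.sum_congr rfl fun i _ => ?_
      split_ifs <;> rfl
    -- Independence of the coins: the sum over all `ε` factorizes over the pairs.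
    have hprod : ∑ ε : Fin m → Bool, ∏ i, h i (ε i) = ∏ i, ∑ c, h i c := by
      rw [Finset.prod_univ_sum, Fintype.piFinset_univ]
    -- The frozen pair contributes `p j` instead of the mean of `p j` and `q j`, an error of at most
    -- `κ / 2` in the exponent per unit of `|t|`. The other `κ / 2` comes from the index possibly
    -- missed by both ranges.
    have hfac : ∀ i, ∑ c, h i c ≤ 2 * Real.exp (t * (p i + q i) / 2 +
        t ^ 2 * (p i ^ 2 + q i ^ 2) / 8 + if i = j then |t| * κ / 2 else 0) := by
      intro i
      have hsq : 0 ≤ t ^ 2 * (p i ^ 2 + q i ^ 2) / 8 := by positivity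
      split_ifs with hij
      · have h2 : ∑ c, h i c = 2 * Real.exp (t * p i) := by
          simp [hh, hij]
        rw [h2]
        gcongr
        have h3 : |t * (p i - q i)| ≤ |t| * κ := by
          rw [abs_mul]
          gcongr
          rw [abs_le]
          constructor <;> linarith [hM (σ (e i)) b, hM (σ (f i)) b, hMκ (σ (e i)) b,
            hMκ (σ (f i)) b]
        have h4 := le_abs_self (t * (p i - q i))
        linarith
      · have h2 : ∑ c, h i c = Real.exp (t * p i) + Real.exp (t * q i) := by
          simp [hh, hij]
          ring
        rw [h2, add_zero]
        exact exp_add_exp_le t _ _ (hM _ _) (hM _ _)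
    have hle : ∏ i, ∑ c, h i c ≤ 2 ^ m * Real.exp (t * d / 2 + |t| * κ + t ^ 2 * κ ^ 2 / 8) := by
      refine (Finset.prod_le_prod (fun i _ => Finset.sum_nonneg fun c _ => (Real.exp_pos _).le)
        fun i _ => hfac i).trans ?_
      rw [Finset.prod_mul_distrib, ← Real.exp_sum]
      simp only [Finset.prod_const, Finset.card_univ, Fintype.card_fin]
      gcongr
      rw [Finset.sum_add_distrib, Finset.sum_add_distrib, ← Finset.sum_div, ← Finset.sum_div,
        ← Finset.mul_sum, ← Finset.mul_sum]
      simp only [Finset.sum_ite_eq', Finset.mem_univ, if_true]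
      have h3 : |t * (∑ i, (p i + q i) - d)| ≤ |t| * κ := by
        rw [abs_mul]
        gcongr
        rw [abs_le]
        constructor <;> linarith [hs1.1, hs1.2]
      have h4 := le_abs_self (t * (∑ i, (p i + q i) - d))
      have h5 : t ^ 2 * ∑ i, (p i ^ 2 + q i ^ 2) ≤ t ^ 2 * κ ^ 2 := by gcongr
      linarith
    rw [Fintype.expect_eq_sum_div_card, Finset.sum_congr rfl fun ε _ => hG1 ε, ← Finset.mul_sum,
      hprod]
    simp only [Fintype.card_pi, Fintype.card_bool, Finset.prod_const, Finset.card_univ,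
      Fintype.card_fin, Nat.cast_pow, Nat.cast_ofNat]
    rw [div_le_iff₀ (by positivity)]
    calc _ ≤ Real.exp (-(t * d / 2)) *
        (2 ^ m * Real.exp (t * d / 2 + |t| * κ + t ^ 2 * κ ^ 2 / 8)) := by gcongr
      _ = _ := by
        rw [mul_left_comm, ← Real.exp_add, mul_comm]
        congr 2
        ring
  calc Finset.expect Finset.univ G =
      Finset.expect Finset.univ (fun ε : Fin m → Bool =>
        Finset.expect Finset.univ (fun σ => G (σ * τ ε))) := by
        simp_rw [expect_perm_mul_right]
        simp
    _ = Finset.expect Finset.univ (fun σ =>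
        Finset.expect Finset.univ (fun ε : Fin m → Bool => G (σ * τ ε))) :=
        Finset.expect_comm _ _ _
    _ ≤ _ := Finset.expect_le Finset.univ_nonempty fun σ _ => hsigma σ

end Permutations

/-! ### From a large bilinear form to a large second singular value. -/

/-- The matrix with rows `(a, b)` and `(c, z)` is so diagonally dominant that it cannot send a
nonzero `(α, β)` to something this small: the first row makes `α` small against `β`, and the second
then kills `β`. -/
theorem abs_coeff_eq_zero_of_le {s S α β a b c z : ℝ} (hs : 0 < s) (hS : S ≤ s / 64)
    (ha : 0.49 * s ≤ a) (hb : |b| ≤ 0.008 * s) (hc : |c| ≤ 0.008 * s) (hz : s / 8 ≤ z)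
    (h1 : |α * a + β * b| ≤ S * (|α| + |β|)) (h2 : |α * c + β * z| ≤ S * (|α| + |β|)) :
    α = 0 ∧ β = 0 := by
  have hα := abs_nonneg α
  have hβ := abs_nonneg β
  have h3 : |α| * a ≤ S * (|α| + |β|) + |β| * |b| := by
    have := abs_sub (α * a + β * b) (β * b)
    rw [add_sub_cancel_right, abs_mul, abs_mul β, abs_of_nonneg (by linarith : 0 ≤ a)] at this
    linarith
  have h4 : |β| * z ≤ S * (|α| + |β|) + |α| * |c| := by
    have := abs_sub (α * c + β * z) (α * c)
    rw [add_sub_cancel_left, abs_mul, abs_mul α, abs_of_nonneg (by linarith : 0 ≤ z)] at this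
    linarith
  have h5 : S * (|α| + |β|) ≤ s / 64 * (|α| + |β|) := by gcongr
  have h6 : |β| * |b| ≤ |β| * (0.008 * s) := by gcongr
  have h7 : |α| * |c| ≤ |α| * (0.008 * s) := by gcongr
  have h8 : |α| * (0.49 * s) ≤ |α| * a := by gcongr
  have h9 : |β| * (s / 8) ≤ |β| * z := by gcongr
  have hα' : |α| ≤ |β| / 10 := by
    refine le_of_mul_le_mul_right (a := s) ?_ hs
    nlinarith
  have hβ' : |β| ≤ 0 := by
    refine le_of_mul_le_mul_right (a := s) ?_ hs
    nlinarith
  have hα'' : |α| ≤ 0 := by linarith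
  exact ⟨abs_nonpos_iff.1 hα'', abs_nonpos_iff.1 hβ'⟩

theorem abs_sum_mul_le {m : ℕ} (x y : Fin m → ℝ) {a b : ℝ} (ha : 0 ≤ a) (hb : 0 ≤ b)
    (hx : ∑ i, x i ^ 2 ≤ a ^ 2) (hy : ∑ i, y i ^ 2 ≤ b ^ 2) : |∑ i, x i * y i| ≤ a * b := by
  refine abs_le_of_sq_le_sq ?_ (by positivity)
  calc _ ≤ (∑ i, x i ^ 2) * ∑ i, y i ^ 2 := Finset.sum_mul_sq_le_sq_mul_sq _ _ _
    _ ≤ a ^ 2 * b ^ 2 := by gcongr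
    _ = _ := by ring

theorem inner_toEuclideanLin_toLp {m : ℕ} (T : Matrix (Fin m) (Fin m) ℝ) (x y : Fin m → ℝ) :
    inner ℝ (WithLp.toLp 2 y : EuclideanSpace ℝ (Fin m))
      (Matrix.toEuclideanLin T (WithLp.toLp 2 x)) = ∑ i, ∑ j, T i j * y i * x j := by
  rw [PiLp.inner_apply]
  refine Finset.sum_congr rfl fun i _ => ?_
  simp only [Matrix.toLpLin_toLp, Matrix.toLin'_apply, Matrix.mulVec, dotProduct,
    RCLike.inner_apply, conj_trivial]
  rw [Finset.sum_mul]
  exact Finset.sum_congr rfl fun j _ => by ring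

/-- A matrix with almost constant row and column sums on which a bilinear form is large at a pair
of vectors almost orthogonal to constants has a large second singular value. -/
theorem le_s₂_of_bilinear {m : ℕ} (hm : 1 < m) (T : Matrix (Fin m) (Fin m) ℝ) (p q : Fin m → ℝ)
    {D δ s : ℝ} (hδ : 0 < δ) (hD : 0 ≤ D) (hs : 1000 * δ ≤ s) (hsD : s ≤ 2 * D)
    (hDm : 10 * D ≤ δ * √m)
    (hp : ∑ j, p j ^ 2 ≤ 1) (hq : ∑ i, q i ^ 2 ≤ 1) (hp1 : |∑ j, p j| ≤ 10)
    (hq1 : |∑ i, q i| ≤ 10)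
    (hu : ∑ j, (∑ i, T i j - D) ^ 2 ≤ 25 * (m * δ ^ 2))
    (hv : ∑ i, (∑ j, T i j - D) ^ 2 ≤ 25 * (m * δ ^ 2))
    (hZ : s / 8 ≤ ∑ i, ∑ j, T i j * q i * p j) : s / 64 ≤ s₂ T := by
  by_contra! hlt
  have hE : 1 < Module.finrank ℝ (EuclideanSpace ℝ (Fin m)) := by simpa using hm
  obtain ⟨φ, hφ⟩ :=
    exists_functional_norm_le_singularValue_one_mul (Matrix.toEuclideanLin T) hE
  change ∀ z, φ z = 0 → _ ≤ s₂ T * ‖z‖ at hφ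
  have hS0 : 0 ≤ s₂ T := (Matrix.toEuclideanLin T).singularValues_nonneg 1
  have hs0 : 0 < s := by linarith
  set r : ℝ := √m with hr
  have hm0 : (0 : ℝ) < m := by
    have : 0 < m := by omega
    exact_mod_cast this
  have hr0 : 0 < r := Real.sqrt_pos.2 hm0
  have hr2 : r ^ 2 = m := Real.sq_sqrt hm0.le
  set o : EuclideanSpace ℝ (Fin m) := WithLp.toLp 2 (fun _ => r⁻¹) with ho
  set P : EuclideanSpace ℝ (Fin m) := WithLp.toLp 2 p with hP
  set Q : EuclideanSpace ℝ (Fin m) := WithLp.toLp 2 q with hQ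
  have hno : ‖o‖ ≤ 1 := by
    rw [EuclideanSpace.norm_eq, Real.sqrt_le_one]
    simp [ho, hr2, hm0.ne']
  have hnP : ‖P‖ ≤ 1 := by
    rw [EuclideanSpace.norm_eq, Real.sqrt_le_one]
    simpa [hP] using hp
  have hnQ : ‖Q‖ ≤ 1 := by
    rw [EuclideanSpace.norm_eq, Real.sqrt_le_one]
    simpa [hQ] using hq
  -- The plane of the normalized constant vector `o` and `P` must meet the kernel of `φ`. Pairing
  -- the image of such a vector with `o` and with `Q` gives the two inequalities that force both
  -- coefficients to vanish.
  obtain ⟨α, β, hαβ, hφαβ⟩ : ∃ α β : ℝ, ¬ (α = 0 ∧ β = 0) ∧ φ (α • o + β • P) = 0 := by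
    by_cases h : φ o = 0
    · exact ⟨1, 0, by simp, by simp [h]⟩
    · refine ⟨φ P, -φ o, fun h' => h (by simpa using h'.2), ?_⟩
      simp only [map_add, map_smul, smul_eq_mul]
      ring
  apply hαβ
  have hTz := hφ _ hφαβ
  have hz : ‖α • o + β • P‖ ≤ |α| + |β| := by
    refine (norm_add_le _ _).trans ?_
    rw [norm_smul, norm_smul, Real.norm_eq_abs, Real.norm_eq_abs]
    have h1 : |α| * ‖o‖ ≤ |α| * 1 := by gcongr
    have h2 : |β| * ‖P‖ ≤ |β| * 1 := by gcongr
    linarith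
  have hpair : ∀ w : EuclideanSpace ℝ (Fin m), ‖w‖ ≤ 1 →
      |α * inner ℝ w (Matrix.toEuclideanLin T o) + β * inner ℝ w (Matrix.toEuclideanLin T P)| ≤
        s₂ T * (|α| + |β|) := by
    intro w hw
    rw [← real_inner_smul_right, ← real_inner_smul_right, ← inner_add_right, ← map_smul,
      ← map_smul, ← map_add]
    calc _ ≤ ‖w‖ * ‖Matrix.toEuclideanLin T (α • o + β • P)‖ := abs_real_inner_le_norm _ _
      _ ≤ 1 * (s₂ T * (|α| + |β|)) := by
        refine mul_le_mul hw (hTz.trans ?_) (norm_nonneg _) zero_le_one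
        gcongr
      _ = _ := one_mul _
  have hcomm : ∀ x y : Fin m → ℝ, ∑ i, ∑ j, T i j * y i * x j =
      ∑ j, (∑ i, T i j * y i) * x j := by
    intro x y
    rw [Finset.sum_comm]
    exact Finset.sum_congr rfl fun j _ => by rw [Finset.sum_mul]
  have hrδ : (5 * r * δ) ^ 2 = 25 * (m * δ ^ 2) := by rw [← hr2]; ring
  rw [← hrδ] at hu hv
  have hDr : D * r⁻¹ ≤ 0.1 * δ := by
    rw [← div_eq_mul_inv, div_le_iff₀ hr0]
    linarith
  -- The degrees split into their deviation from `D`, handled by Cauchy-Schwarz (`5δ`), and the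
  -- constant `D`, which sees only the bounded sum of `x` (`δ`). The total `6δ` is below `0.008 s`.
  have hcross : ∀ (w x : Fin m → ℝ), ∑ j, (w j - D) ^ 2 ≤ (5 * r * δ) ^ 2 → ∑ j, x j ^ 2 ≤ 1 →
      |∑ j, x j| ≤ 10 → |∑ j, w j * r⁻¹ * x j| ≤ 0.008 * s := by
    intro w x hw hx hx1
    have h1 : ∑ j, w j * r⁻¹ * x j = r⁻¹ * ∑ j, (w j - D) * x j + D * r⁻¹ * ∑ j, x j := by
      rw [Finset.mul_sum, Finset.mul_sum, ← Finset.sum_add_distrib]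
      exact Finset.sum_congr rfl fun j _ => by ring
    have h2 := abs_sum_mul_le (fun j => w j - D) x (b := 1) (by positivity) zero_le_one hw
      (by simpa using hx)
    rw [h1]
    refine (abs_add_le _ _).trans ?_
    rw [abs_mul, abs_mul, abs_of_pos (inv_pos.2 hr0), abs_of_nonneg (by positivity : 0 ≤ D * r⁻¹)]
    have h3 : r⁻¹ * |∑ j, (w j - D) * x j| ≤ r⁻¹ * (5 * r * δ * 1) := by gcongr
    have h4 : r⁻¹ * (5 * r * δ * 1) = 5 * δ := by field_simp
    have h5 : D * r⁻¹ * |∑ j, x j| ≤ 0.1 * δ * 10 := by gcongr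
    linarith
  refine abs_coeff_eq_zero_of_le hs0 hlt.le (a := inner ℝ o (Matrix.toEuclideanLin T o))
    (b := inner ℝ o (Matrix.toEuclideanLin T P)) (c := inner ℝ Q (Matrix.toEuclideanLin T o))
    (z := inner ℝ Q (Matrix.toEuclideanLin T P)) ?_ ?_ ?_ ?_ (hpair o hno) (hpair Q hnQ)
  · rw [ho, inner_toEuclideanLin_toLp, hcomm]
    have h1 : ∑ j, (∑ i, T i j * r⁻¹) * r⁻¹ = D + r⁻¹ * r⁻¹ * ∑ j, (∑ i, T i j - D) * 1 := by
      rw [Finset.mul_sum]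
      have : D = ∑ _j : Fin m, r⁻¹ * r⁻¹ * D := by
        simp
        rw [← hr2]
        field_simp
      nth_rw 1 [this]
      rw [← Finset.sum_add_distrib]
      exact Finset.sum_congr rfl fun j _ => by rw [← Finset.sum_mul]; ring
    have h2 := abs_sum_mul_le (fun j => ∑ i, T i j - D) (fun _ => 1) (by positivity) hr0.le hu
      (by simp [hr2])
    rw [h1]
    have h3 : |r⁻¹ * r⁻¹ * ∑ j, (∑ i, T i j - D) * 1| ≤ r⁻¹ * r⁻¹ * (5 * r * δ * r) := by
      rw [abs_mul, abs_of_pos (by positivity : 0 < r⁻¹ * r⁻¹)]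
      gcongr
    have h4 : r⁻¹ * r⁻¹ * (5 * r * δ * r) = 5 * δ := by field_simp
    have h5 := (abs_le.1 h3).1
    linarith
  · rw [ho, hP, inner_toEuclideanLin_toLp, hcomm]
    simp_rw [← Finset.sum_mul]
    exact hcross _ p hu hp hp1
  · rw [ho, hQ, inner_toEuclideanLin_toLp]
    have : ∀ i, ∑ j, T i j * q i * r⁻¹ = (∑ j, T i j) * r⁻¹ * q i := by
      intro i
      rw [← Finset.sum_mul, ← Finset.sum_mul]
      ring
    simp_rw [this]
    exact hcross _ q hv hq hq1
  · rw [hQ, hP, inner_toEuclideanLin_toLp]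
    exact hZ

/-! ### The maximal bilinear form on zero-sum vectors. -/

section Maximizer

variable {n : ℕ}

/-- AM-GM on each product `y i * x j`, then the row and column sums. This ensures that the constant
direction of the corner dominates the scale `s`. -/
theorem bilinear_le_of_regular {A : Matrix (Fin n) (Fin n) ℝ} {d : ℝ} (hA : ∀ i j, 0 ≤ A i j)
    (hrow : ∀ i, ∑ j, A i j = d) (hcol : ∀ j, ∑ i, A i j = d) (hd : 0 ≤ d) {x y : Fin n → ℝ}
    (hx : ∑ j, x j ^ 2 ≤ 1) (hy : ∑ i, y i ^ 2 ≤ 1) : ∑ i, ∑ j, A i j * y i * x j ≤ d := by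
  calc ∑ i, ∑ j, A i j * y i * x j ≤ ∑ i, ∑ j, (A i j * y i ^ 2 / 2 + A i j * x j ^ 2 / 2) := by
        refine Finset.sum_le_sum fun i _ => Finset.sum_le_sum fun j _ => ?_
        nlinarith [mul_nonneg (hA i j) (sq_nonneg (y i - x j))]
    _ = ∑ i, (∑ j, A i j) * y i ^ 2 / 2 + ∑ j, (∑ i, A i j) * x j ^ 2 / 2 := by
        simp_rw [Finset.sum_add_distrib, Finset.sum_mul, Finset.sum_div]
        congr 1
        exact Finset.sum_comm
    _ = d * (∑ i, y i ^ 2) / 2 + d * (∑ j, x j ^ 2) / 2 := by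
        simp_rw [hrow, hcol, Finset.mul_sum, Finset.sum_div]
    _ ≤ d * 1 / 2 + d * 1 / 2 := by gcongr
    _ = d := by ring

/-- The Courant-Fischer plane contains a nonzero zero-sum `z`. Equal column sums make `A z` zero-sum
as well, so `z` and `A z`, normalized, serve as test vectors. -/
theorem exists_bilinear_ge_s₂ (hn : 1 < n) {A : Matrix (Fin n) (Fin n) ℝ} {d t : ℝ}
    (hcol : ∀ j, ∑ i, A i j = d) (ht : 0 < t) (hs : t ≤ s₂ A) :
    ∃ x y : Fin n → ℝ, ∑ j, x j = 0 ∧ ∑ i, y i = 0 ∧ ∑ j, x j ^ 2 ≤ 1 ∧ ∑ i, y i ^ 2 ≤ 1 ∧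
      t ≤ ∑ i, ∑ j, A i j * y i * x j := by
  have hE : 1 < Module.finrank ℝ (EuclideanSpace ℝ (Fin n)) := by simpa using hn
  obtain ⟨V, hV, hT⟩ :=
    exists_submodule_singularValue_one_mul_norm_le (Matrix.toEuclideanLin A) hE
  change ∀ z ∈ V, s₂ A * ‖z‖ ≤ _ at hT
  obtain ⟨z, hzV, hz0, hz⟩ := exists_mem_ne_zero_of_finrank_eq_two hV
    (innerₛₗ ℝ (WithLp.toLp 2 (fun _ => (1 : ℝ)) : EuclideanSpace ℝ (Fin n)))
  replace hz : ∑ j, z j = 0 := by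
    simpa [PiLp.inner_apply] using hz
  set Y := Matrix.toEuclideanLin A z with hY
  have hnz : 0 < ‖z‖ := norm_pos_iff.2 hz0
  have hnY : t * ‖z‖ ≤ ‖Y‖ := le_trans (by gcongr) (hT z hzV)
  have hnY0 : 0 < ‖Y‖ := lt_of_lt_of_le (by positivity) hnY
  have hunit : ∀ w : EuclideanSpace ℝ (Fin n), 0 < ‖w‖ → ∑ i, (‖w‖⁻¹ * w i) ^ 2 ≤ 1 := by
    intro w hw
    simp_rw [mul_pow]
    rw [← Finset.mul_sum, ← EuclideanSpace.real_norm_sq_eq, inv_pow, inv_mul_cancel₀]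
    positivity
  refine ⟨fun j => ‖z‖⁻¹ * z j, fun i => ‖Y‖⁻¹ * Y i, ?_, ?_, hunit z hnz, hunit Y hnY0, ?_⟩
  · rw [← Finset.mul_sum, hz, mul_zero]
  · have : ∑ i, Y i = 0 := by
      have h1 : ∀ i, Y i = ∑ j, A i j * z j := fun i => by
        simp [hY, Matrix.toLpLin_apply, Matrix.mulVec, dotProduct]
      simp_rw [h1]
      rw [Finset.sum_comm]
      simp_rw [← Finset.sum_mul, hcol]
      rw [← Finset.mul_sum, hz, mul_zero]
    rw [← Finset.mul_sum, this, mul_zero]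
  · have h1 : ∑ i, ∑ j, A i j * (‖Y‖⁻¹ * Y i) * (‖z‖⁻¹ * z j) =
        ‖Y‖⁻¹ * ‖z‖⁻¹ * ∑ i, ∑ j, A i j * Y i * z j := by
      simp_rw [Finset.mul_sum]
      refine Finset.sum_congr rfl fun i _ => Finset.sum_congr rfl fun j _ => ?_
      ring
    have h2 : ∑ i, ∑ j, A i j * Y i * z j = ‖Y‖ ^ 2 := by
      rw [← inner_toEuclideanLin_toLp, ← real_inner_self_eq_norm_sq]
    rw [h1, h2]
    have h3 : ‖Y‖⁻¹ * ‖z‖⁻¹ * ‖Y‖ ^ 2 = ‖Y‖ / ‖z‖ := by field_simp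
    rw [h3, le_div_iff₀ hnz]
    exact hnY

/-- Compactness. Working with a maximizer gives an upper bound at the same level `s` for all other
test vectors, in particular for restrictions of `x` and `y`. -/
theorem exists_isMax_bilinear (A : Matrix (Fin n) (Fin n) ℝ) :
    ∃ x y : Fin n → ℝ, ∑ j, x j = 0 ∧ ∑ i, y i = 0 ∧ ∑ j, x j ^ 2 ≤ 1 ∧ ∑ i, y i ^ 2 ≤ 1 ∧
      ∀ x' y' : Fin n → ℝ, ∑ j, x' j = 0 → ∑ i, y' i = 0 → ∑ j, x' j ^ 2 ≤ 1 →
        ∑ i, y' i ^ 2 ≤ 1 →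
        ∑ i, ∑ j, A i j * y' i * x' j ≤ ∑ i, ∑ j, A i j * y i * x j := by
  set K : Set ((Fin n → ℝ) × (Fin n → ℝ)) :=
    {z | (∑ j, z.1 j = 0 ∧ ∑ j, z.2 j = 0) ∧ (∑ j, z.1 j ^ 2 ≤ 1 ∧ ∑ j, z.2 j ^ 2 ≤ 1)} with hK
  have hbox : ∀ x : Fin n → ℝ, ∑ j, x j ^ 2 ≤ 1 → ∀ j, -1 ≤ x j ∧ x j ≤ 1 := by
    intro x hx j
    rw [← abs_le, ← sq_le_one_iff_abs_le_one]
    exact (Finset.single_le_sum (f := fun j => x j ^ 2) (fun j _ => sq_nonneg _)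
      (Finset.mem_univ j)).trans hx
  have hcl : IsClosed K := by
    have h1 : IsClosed {z : (Fin n → ℝ) × (Fin n → ℝ) | ∑ j, z.1 j = 0} :=
      isClosed_eq (by fun_prop) (by fun_prop)
    have h2 : IsClosed {z : (Fin n → ℝ) × (Fin n → ℝ) | ∑ j, z.2 j = 0} :=
      isClosed_eq (by fun_prop) (by fun_prop)
    have h3 : IsClosed {z : (Fin n → ℝ) × (Fin n → ℝ) | ∑ j, z.1 j ^ 2 ≤ 1} :=
      isClosed_le (by fun_prop) (by fun_prop)
    have h4 : IsClosed {z : (Fin n → ℝ) × (Fin n → ℝ) | ∑ j, z.2 j ^ 2 ≤ 1} :=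
      isClosed_le (by fun_prop) (by fun_prop)
    exact (h1.inter h2).inter (h3.inter h4)
  have hcomp : IsCompact K := by
    refine (isCompact_Icc (a := ((fun _ => -1, fun _ => -1) : (Fin n → ℝ) × (Fin n → ℝ)))
      (b := (fun _ => 1, fun _ => 1))).of_isClosed_subset hcl ?_
    rintro ⟨x, y⟩ ⟨-, hx, hy⟩
    exact ⟨⟨fun j => (hbox x hx j).1, fun j => (hbox y hy j).1⟩,
      ⟨fun j => (hbox x hx j).2, fun j => (hbox y hy j).2⟩⟩
  obtain ⟨⟨x, y⟩, ⟨⟨h1, h2⟩, h3, h4⟩, hmax⟩ := hcomp.exists_isMaxOn ⟨0, by simp [hK]⟩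
    (f := fun z => ∑ i, ∑ j, A i j * z.2 i * z.1 j) (Continuous.continuousOn (by fun_prop))
  exact ⟨x, y, h1, h2, h3, h4, fun x' y' h1' h2' h3' h4' =>
    hmax (show (x', y') ∈ K from ⟨⟨h1', h2'⟩, h3', h4'⟩)⟩

theorem sum_sub_mean (hn : 0 < n) (x : Fin n → ℝ) : ∑ j, (x j - (∑ i, x i) / n) = 0 := by
  have : (n : ℝ) ≠ 0 := by positivity
  simp
  field_simp
  ring

theorem sum_sq_sub_mean_le (hn : 0 < n) (x : Fin n → ℝ) :
    ∑ j, (x j - (∑ i, x i) / n) ^ 2 ≤ ∑ j, x j ^ 2 := by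
  have h0 : (n : ℝ) ≠ 0 := by positivity
  set μ := (∑ i, x i) / n with hμ
  have h1 : ∑ i, x i = n * μ := by rw [hμ]; field_simp
  have h2 : ∑ j, (x j - μ) ^ 2 = ∑ j, x j ^ 2 - n * μ ^ 2 := by
    simp_rw [sub_sq]
    rw [Finset.sum_add_distrib, Finset.sum_sub_distrib, ← Finset.sum_mul, ← Finset.mul_sum, h1]
    simp
    ring
  rw [h2]
  have : 0 ≤ n * μ ^ 2 := by positivity
  linarith

/-- A bound of the bilinear form on the vectors orthogonal to constants extends to all vectors. -/
theorem bilinear_le_add_mean (hn : 0 < n) {A : Matrix (Fin n) (Fin n) ℝ} {d s : ℝ}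
    (hrow : ∀ i, ∑ j, A i j = d) (hcol : ∀ j, ∑ i, A i j = d)
    (hmax : ∀ x' y' : Fin n → ℝ, ∑ j, x' j = 0 → ∑ i, y' i = 0 → ∑ j, x' j ^ 2 ≤ 1 →
      ∑ i, y' i ^ 2 ≤ 1 → ∑ i, ∑ j, A i j * y' i * x' j ≤ s) {x y : Fin n → ℝ}
    (hx : ∑ j, x j ^ 2 ≤ 1) (hy : ∑ i, y i ^ 2 ≤ 1) :
    ∑ i, ∑ j, A i j * y i * x j ≤ s + d / n * ((∑ j, x j) * ∑ i, y i) := by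
  have h0 : (n : ℝ) ≠ 0 := by positivity
  have h := hmax (fun j => x j - (∑ i, x i) / n) (fun j => y j - (∑ i, y i) / n)
    (sum_sub_mean hn x) (sum_sub_mean hn y) ((sum_sq_sub_mean_le hn x).trans hx)
    ((sum_sq_sub_mean_le hn y).trans hy)
  set μ := (∑ i, x i) / n with hμ
  set ν := (∑ i, y i) / n with hν
  have hx1 : ∑ i, x i = n * μ := by rw [hμ]; field_simp
  have hy1 : ∑ i, y i = n * ν := by rw [hν]; field_simp
  have e1 : ∑ i, ∑ j, A i j * (y i - ν) * (x j - μ) = ∑ i, ∑ j, A i j * y i * x j -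
      μ * ∑ i, (∑ j, A i j) * y i - ν * ∑ j, (∑ i, A i j) * x j + μ * ν * ∑ i, ∑ j, A i j := by
    simp_rw [Finset.sum_mul]
    rw [Finset.sum_comm (f := fun j i => A i j * x j)]
    simp_rw [Finset.mul_sum, ← Finset.sum_sub_distrib, ← Finset.sum_add_distrib]
    refine Finset.sum_congr rfl fun i _ => Finset.sum_congr rfl fun j _ => ?_
    ring
  simp_rw [hrow, hcol, ← Finset.mul_sum, hx1, hy1] at e1
  rw [e1] at h
  rw [hx1, hy1]
  simp only [Finset.sum_const, Finset.card_univ, Fintype.card_fin, nsmul_eq_mul] at h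
  have e2 : d / n * (n * μ * (n * ν)) = μ * ν * (n * d) := by field_simp
  rw [e2]
  linarith

theorem sum_ite_mem_range_mul {m : ℕ} {f : Fin m → Fin n} (hf : Function.Injective f)
    (g : Fin n → ℝ) [DecidablePred (· ∈ Set.range f)] :
    ∑ a, (if a ∈ Set.range f then g a else 0) = ∑ j, g (f j) := by
  rw [← Finset.sum_filter]
  have : Finset.univ.filter (· ∈ Set.range f) = Finset.univ.map ⟨f, hf⟩ := by
    ext a
    simp
  rw [this, Finset.sum_map]
  rfl

/-- Extend the restricted vectors by zero: their norms do not grow, and centering them costs only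
the product of their sums times `d / n`. -/
theorem bilinear_submatrix_le {m : ℕ} (hn : 0 < n) {A : Matrix (Fin n) (Fin n) ℝ} {d s : ℝ}
    (hrow : ∀ i, ∑ j, A i j = d) (hcol : ∀ j, ∑ i, A i j = d)
    (hmax : ∀ x' y' : Fin n → ℝ, ∑ j, x' j = 0 → ∑ i, y' i = 0 → ∑ j, x' j ^ 2 ≤ 1 →
      ∑ i, y' i ^ 2 ≤ 1 → ∑ i, ∑ j, A i j * y' i * x' j ≤ s) {x y : Fin n → ℝ}
    (hx : ∑ j, x j ^ 2 ≤ 1) (hy : ∑ i, y i ^ 2 ≤ 1) {e f : Fin m → Fin n}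
    (he : Function.Injective e) (hf : Function.Injective f) :
    ∑ i, ∑ j, A (e i) (f j) * y (e i) * x (f j) ≤
      s + d / n * ((∑ j, x (f j)) * ∑ i, y (e i)) := by
  classical
  have hsq : ∀ (z : Fin n → ℝ) (g : Fin m → Fin n), ∑ j, z j ^ 2 ≤ 1 →
      ∑ j, (if j ∈ Set.range g then z j else 0) ^ 2 ≤ 1 := by
    intro z g hz
    refine (Finset.sum_le_sum fun j _ => ?_).trans hz
    split_ifs
    · exact le_rfl
    · simpa using sq_nonneg (z j)
  have h := bilinear_le_add_mean hn hrow hcol hmax (hsq x f hx) (hsq y e hy)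
  rw [sum_ite_mem_range_mul hf, sum_ite_mem_range_mul he] at h
  convert h using 1
  have hinner : ∀ (a : Fin n) (c : ℝ),
      ∑ b, A a b * c * (if b ∈ Set.range f then x b else 0) =
        ∑ j, A a (f j) * c * x (f j) := by
    intro a c
    rw [← sum_ite_mem_range_mul hf (fun b => A a b * c * x b)]
    exact Finset.sum_congr rfl fun b _ => by split_ifs <;> simp
  rw [← sum_ite_mem_range_mul he (fun a => ∑ j, A a (f j) * y a * x (f j))]
  refine Finset.sum_congr rfl fun a _ => ?_
  rw [hinner]
  split_ifs <;> simp

end Maximizer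

/-! ### Gaussian tails of the degrees via one exponential functional. -/

/-- An exponential functional of `w`, small when the entries of `w / δ` have Gaussian tails
up to the level `K`. -/
noncomputable def expDev {m : ℕ} (K : ℕ) (δ : ℝ) (w : Fin m → ℝ) : ℝ :=
  ∑ k ∈ Finset.Icc 1 K, Real.exp (-(7 * (k : ℝ) ^ 2)) *
    ((m : ℝ)⁻¹ * ∑ j, (Real.exp (8 * k / δ * w j) + Real.exp (-(8 * k / δ) * w j)))

theorem sq_le_exp_of_nonneg {x : ℝ} (hx : 0 ≤ x) : x ^ 2 ≤ Real.exp x := by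
  have h := Real.quadratic_le_exp_of_nonneg (by positivity : 0 ≤ x / 2)
  have h1 : Real.exp x = Real.exp (x / 2) ^ 2 := by
    rw [← Real.exp_nat_mul]
    ring_nf
  rw [h1]
  gcongr
  nlinarith [sq_nonneg (x - 2)]

theorem sq_le_exp_add_exp_neg (x : ℝ) : x ^ 2 ≤ Real.exp x + Real.exp (-x) := by
  have h1 := Real.exp_pos x
  have h2 := Real.exp_pos (-x)
  rcases le_total 0 x with h | h
  · linarith [sq_le_exp_of_nonneg h]
  · have := sq_le_exp_of_nonneg (neg_nonneg.2 h)
    rw [neg_sq] at this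
    linarith

section ExpDev

variable {m K : ℕ} {δ : ℝ} {w : Fin m → ℝ}

theorem expDev_nonneg : 0 ≤ expDev K δ w := by
  unfold expDev
  positivity

theorem sum_exp_le_of_expDev_le_one (hm : 0 < m) (h : expDev K δ w ≤ 1) {k : ℕ} (hk : 1 ≤ k)
    (hkK : k ≤ K) : ∑ j, (Real.exp (8 * k / δ * w j) + Real.exp (-(8 * k / δ) * w j)) ≤
      m * Real.exp (7 * (k : ℝ) ^ 2) := by
  have h1 : Real.exp (-(7 * (k : ℝ) ^ 2)) *
      ((m : ℝ)⁻¹ * ∑ j, (Real.exp (8 * k / δ * w j) + Real.exp (-(8 * k / δ) * w j))) ≤ 1 := by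
    refine le_trans (Finset.single_le_sum (f := fun k : ℕ => Real.exp (-(7 * (k : ℝ) ^ 2)) *
      ((m : ℝ)⁻¹ * ∑ j, (Real.exp (8 * k / δ * w j) + Real.exp (-(8 * k / δ) * w j))))
      (fun k _ => by positivity) (Finset.mem_Icc.2 ⟨hk, hkK⟩)) h
  have hm' : (0 : ℝ) < m := by exact_mod_cast hm
  rw [Real.exp_neg, ← mul_assoc, ← mul_inv, inv_mul_le_iff₀ (by positivity)] at h1
  linarith

/-- Markov's inequality at exponent `8k/δ`: each entry counted contributes at least `exp (8k²)` to a
sum of at most `m exp (7k²)`. Above level `K` there is nothing to count. -/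
theorem card_filter_le_of_expDev_le_one (hm : 0 < m) (hδ : 0 < δ) (h : expDev K δ w ≤ 1)
    (hw : ∀ j, |w j| ≤ K * δ) (k : ℕ) :
    ((Finset.univ.filter fun j => (k : ℝ) * δ < |w j|).card : ℝ) ≤
      m * Real.exp (-(k : ℝ) ^ 2) := by
  rcases Nat.eq_zero_or_pos k with rfl | hk
  · simpa using Finset.card_le_univ (Finset.univ.filter fun j => (0 : ℝ) < |w j|)
  rcases lt_or_ge K k with hkK | hkK
  · rw [Finset.filter_eq_empty_iff.2]
    · simp
      positivity
    · intro j _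
      rw [not_lt]
      refine (hw j).trans ?_
      gcongr
  have h1 := sum_exp_le_of_expDev_le_one hm h hk hkK
  have h2 : ((Finset.univ.filter fun j => (k : ℝ) * δ < |w j|).card : ℝ) *
      Real.exp (8 * (k : ℝ) ^ 2) ≤ m * Real.exp (7 * (k : ℝ) ^ 2) := by
    refine le_trans ?_ h1
    rw [← nsmul_eq_mul]
    refine (Finset.card_nsmul_le_sum _ _ _ fun j hj => ?_).trans
      (Finset.sum_le_sum_of_subset_of_nonneg (Finset.filter_subset _ _) fun j _ _ => by positivity)
    replace hj := (Finset.mem_filter.1 hj).2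
    have h3 : 8 * (k : ℝ) ^ 2 ≤ 8 * k / δ * |w j| := by
      rw [div_mul_eq_mul_div, le_div_iff₀ hδ]
      nlinarith [mul_le_mul_of_nonneg_left hj.le (by positivity : (0 : ℝ) ≤ 8 * k)]
    rcases abs_choice (w j) with hc | hc
    · rw [hc] at h3
      have := Real.exp_pos (-(8 * k / δ) * w j)
      linarith [Real.exp_le_exp.2 h3]
    · rw [hc, mul_neg, ← neg_mul] at h3
      have := Real.exp_pos (8 * k / δ * w j)
      linarith [Real.exp_le_exp.2 h3]
  rw [← le_div_iff₀ (Real.exp_pos _), mul_div_assoc, ← Real.exp_sub] at h2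
  refine h2.trans (le_of_eq ?_)
  ring_nf

theorem sum_sq_le_of_expDev_le_one (hm : 0 < m) (hδ : 0 < δ) (hK : 1 ≤ K)
    (h : expDev K δ w ≤ 1) : ∑ j, w j ^ 2 ≤ 25 * (m * δ ^ 2) := by
  have h1 := sum_exp_le_of_expDev_le_one hm h le_rfl hK
  simp only [Nat.cast_one, mul_one, one_pow] at h1
  have h2 : ∑ j, (8 / δ * w j) ^ 2 ≤ m * Real.exp 7 := by
    refine (Finset.sum_le_sum fun j _ => ?_).trans h1
    rw [neg_mul]
    set x := 8 / δ * w j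
    exact sq_le_exp_add_exp_neg x
  -- The term `k = 1` bounds `(8/δ)² ∑ w²` by `m e⁷`, and `25 = 1600 / 8²`.
  have h7 : Real.exp 7 ≤ 1600 := by
    have h8 : Real.exp 7 = Real.exp 1 ^ 7 := by
      rw [← Real.exp_nat_mul]
      norm_num
    rw [h8]
    calc _ ≤ (2.7182818286 : ℝ) ^ 7 := by
          gcongr
          exact Real.exp_one_lt_d9.le
      _ ≤ 1600 := by norm_num
  simp_rw [mul_pow] at h2
  rw [← Finset.mul_sum, div_pow, div_mul_eq_mul_div, div_le_iff₀ (by positivity)] at h2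
  have h9 : m * Real.exp 7 * δ ^ 2 ≤ m * 1600 * δ ^ 2 := by gcongr
  linarith

/-- The scale `δ / 1000` makes each moment at exponent `8k/δ` at most `exp (k²)`; the weight `exp
(-7k²)` leaves a summable `2 exp (-6k²)`, whatever `K` is. -/
theorem expect_expDev_le {ι : Type*} [Fintype ι] [Nonempty ι] (hδ : 0 < δ) (W : ι → Fin m → ℝ)
    (hW : ∀ j t, Finset.expect Finset.univ (fun σ => Real.exp (t * W σ j)) ≤
      Real.exp (|t| * (δ / 1000) + t ^ 2 * (δ / 1000) ^ 2 / 8)) :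
    Finset.expect Finset.univ (fun σ => expDev K δ (W σ)) ≤ 1 / 100 := by
  have hterm : ∀ k ∈ Finset.Icc 1 K, Finset.expect Finset.univ (fun σ =>
      Real.exp (-(7 * (k : ℝ) ^ 2)) * ((m : ℝ)⁻¹ * ∑ j, (Real.exp (8 * k / δ * W σ j) +
        Real.exp (-(8 * k / δ) * W σ j)))) ≤ 2 * (Real.exp (-6)) ^ k := by
    intro k hk
    have hk1 : (1 : ℝ) ≤ k := by exact_mod_cast (Finset.mem_Icc.1 hk).1
    have hpos : 0 ≤ 8 * (k : ℝ) / δ := by positivity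
    rw [← Finset.mul_expect, ← Finset.mul_expect, Finset.expect_sum_comm]
    simp_rw [Finset.expect_add_distrib]
    have hB : ∀ j, Finset.expect Finset.univ (fun σ => Real.exp (8 * k / δ * W σ j)) +
        Finset.expect Finset.univ (fun σ => Real.exp (-(8 * k / δ) * W σ j)) ≤
        2 * Real.exp ((k : ℝ) ^ 2) := by
      intro j
      have h1 := hW j (8 * k / δ)
      have h2 := hW j (-(8 * k / δ))
      rw [abs_neg, neg_sq] at h2
      rw [abs_of_nonneg hpos] at h1 h2
      have h3 : 8 * k / δ * (δ / 1000) + (8 * k / δ) ^ 2 * (δ / 1000) ^ 2 / 8 ≤ (k : ℝ) ^ 2 := by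
        field_simp
        nlinarith
      have h4 := Real.exp_le_exp.2 h3
      linarith
    have hS : (m : ℝ)⁻¹ * ∑ j : Fin m,
        (Finset.expect Finset.univ (fun σ => Real.exp (8 * k / δ * W σ j)) +
        Finset.expect Finset.univ (fun σ => Real.exp (-(8 * k / δ) * W σ j))) ≤
        2 * Real.exp ((k : ℝ) ^ 2) := by
      have h5 := Finset.sum_le_sum fun j (_ : j ∈ Finset.univ) => hB j
      simp only [Finset.sum_const, Finset.card_univ, Fintype.card_fin, nsmul_eq_mul] at h5
      rcases Nat.eq_zero_or_pos m with h | h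
      · subst h
        simp
        positivity
      · rw [inv_mul_le_iff₀ (by exact_mod_cast h)]
        exact h5
    calc _ ≤ Real.exp (-(7 * (k : ℝ) ^ 2)) * (2 * Real.exp ((k : ℝ) ^ 2)) := by gcongr
      _ = 2 * Real.exp (-6 * (k : ℝ) ^ 2) := by
        rw [mul_left_comm, ← Real.exp_add]
        ring_nf
      _ ≤ 2 * Real.exp (-6 * k) := by
        gcongr 2 * Real.exp ?_
        nlinarith
      _ = _ := by
        rw [← Real.exp_nat_mul]
        ring_nf
  have h6 : Real.exp (-6) ≤ 1 / 400 := by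
    have h8 : Real.exp 6 = Real.exp 1 ^ 6 := by
      rw [← Real.exp_nat_mul]
      norm_num
    rw [Real.exp_neg, h8, one_div]
    apply inv_anti₀ (by norm_num)
    calc (400 : ℝ) ≤ (2.7182818283 : ℝ) ^ 6 := by norm_num
      _ ≤ _ := by
        gcongr
        exact Real.exp_one_gt_d9.le
  unfold expDev
  rw [Finset.expect_sum_comm]
  calc _ ≤ ∑ k ∈ Finset.Icc 1 K, 2 * (Real.exp (-6)) ^ k := Finset.sum_le_sum hterm
    _ = 2 * ∑ k ∈ Finset.Ico 1 (K + 1), (Real.exp (-6)) ^ k := by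
      rw [← Finset.mul_sum]
      rfl
    _ ≤ 2 * (Real.exp (-6) ^ 1 / (1 - Real.exp (-6))) := by
      gcongr
      exact geom_sum_Ico_le_of_lt_one (Real.exp_pos _).le (by linarith)
    _ ≤ 1 / 100 := by
      rw [pow_one, mul_div_assoc', div_le_div_iff₀ (by linarith) (by norm_num)]
      linarith

end ExpDev

/-! ### The corner of a randomly relabelled regular matrix. -/

section Corner

variable {n : ℕ}

/-- The position in `Fin n` of the `i`-th row of the top right corner. -/
def topIdx (i : Fin (n / 2)) : Fin n := ⟨i, by omega⟩

/-- The position in `Fin n` of the `j`-th column of the top right corner. -/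
def rightIdx (j : Fin (n / 2)) : Fin n := ⟨n - n / 2 + j, by omega⟩

theorem topIdx_injective : Function.Injective (topIdx (n := n)) := fun i j h =>
  Fin.ext (by simpa [topIdx] using h)

theorem rightIdx_injective : Function.Injective (rightIdx (n := n)) := fun i j h =>
  Fin.ext (by simpa [rightIdx] using h)

theorem topIdx_ne_rightIdx (i j : Fin (n / 2)) : topIdx i ≠ rightIdx j := fun h => by
  have := congrArg Fin.val h
  simp only [topIdx, rightIdx] at this
  omega

theorem colNorms_eq_sum {m : ℕ} {A : Matrix (Fin m) (Fin m) ℝ} (hA : ∀ i j, 0 ≤ A i j)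
    (j : Fin m) : colNorms A j = ∑ i, A i j := by
  simp [colNorms, PiLp.norm_eq_of_nat 1 Nat.cast_one.symm, abs_of_nonneg (hA _ _)]

theorem rowNorms_eq_sum {m : ℕ} {A : Matrix (Fin m) (Fin m) ℝ} (hA : ∀ i j, 0 ≤ A i j)
    (i : Fin m) : rowNorms A i = ∑ j, A i j := by
  simp [rowNorms, PiLp.norm_eq_of_nat 1 Nat.cast_one.symm, abs_of_nonneg (hA _ _)]

theorem mem_Deg_of_expDev_le_one {m K : ℕ} (hm : 0 < m) {T : Matrix (Fin m) (Fin m) ℝ}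
    (hT : ∀ i j, 0 ≤ T i j) {D δ : ℝ} (hδ : 0 < δ) (hDK : D ≤ K * δ)
    (hcol : ∀ j, ∑ i, T i j ≤ 2 * D) (hrow : ∀ i, ∑ j, T i j ≤ 2 * D)
    (hu : expDev K δ (fun j => ∑ i, T i j - D) ≤ 1)
    (hv : expDev K δ (fun i => ∑ j, T i j - D) ≤ 1) :
    (colNorms T, rowNorms T) ∈ Deg m D δ := by
  have hc : colNorms T = fun j => ∑ i, T i j := funext fun j => colNorms_eq_sum hT j
  have hr : rowNorms T = fun i => ∑ j, T i j := funext fun i => rowNorms_eq_sum hT i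
  rw [hc, hr]
  have hcn : ∀ j, 0 ≤ ∑ i, T i j := fun j => Finset.sum_nonneg fun i _ => hT i j
  have hrn : ∀ i, 0 ≤ ∑ j, T i j := fun i => Finset.sum_nonneg fun j _ => hT i j
  refine ⟨hcn, hrn, ?_, card_filter_le_of_expDev_le_one hm hδ hu fun j => ?_,
    card_filter_le_of_expDev_le_one hm hδ hv fun i => ?_⟩
  · simp only [PiLp.norm_eq_of_nat 1 Nat.cast_one.symm,
      Real.norm_eq_abs, abs_of_nonneg (hcn _), abs_of_nonneg (hrn _)]
    rw [Finset.sum_congr rfl fun j _ => by rw [pow_one],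
      Finset.sum_comm]
    simp
  · rw [abs_le]
    constructor <;> linarith [hcol j, hcn j]
  · rw [abs_le]
    constructor <;> linarith [hrow i, hrn i]

/-- The matrices whose top right corner has large second singular value and almost constant
degrees. -/
def cornerEvent (n : ℕ) (d δ a : ℝ) : Set (Matrix (Fin n) (Fin n) ℝ) :=
  {M | a ≤ s₂ (topRight M) ∧
    (colNorms (topRight M), rowNorms (topRight M)) ∈ Deg (n / 2) (d / 2) δ}

theorem topRight_permute_mem_of_bounds (hn : 1000 ≤ n) {A : Matrix (Fin n) (Fin n) ℝ}
    {d δ s : ℝ} (hδ : 0 < δ) (hA : ∀ i j, 0 ≤ A i j) (hrow : ∀ i, ∑ j, A i j = d)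
    (hcol : ∀ j, ∑ i, A i j = d) (hdn : d ^ 2 ≤ n * (δ / 1000) ^ 2) (hs : 1000 * δ ≤ s)
    (hsd : s ≤ d) {x y : Fin n → ℝ} (hx : ∑ j, x j ^ 2 ≤ 1) (hy : ∑ i, y i ^ 2 ≤ 1)
    {K : ℕ} (hK : 1 ≤ K) (hKd : d ≤ K * δ) (σ : Equiv.Perm (Fin n))
    (hX : (∑ j, x (σ (rightIdx j))) ^ 2 ≤ 100) (hY : (∑ i, y (σ (topIdx i))) ^ 2 ≤ 100)
    (hu : expDev K δ (fun j => ∑ i, A (σ (topIdx i)) (σ (rightIdx j)) - d / 2) ≤ 1)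
    (hv : expDev K δ (fun i => ∑ j, A (σ (topIdx i)) (σ (rightIdx j)) - d / 2) ≤ 1)
    (hZ : s / 8 ≤ ∑ i, ∑ j, A (σ (topIdx i)) (σ (rightIdx j)) * y (σ (topIdx i)) *
      x (σ (rightIdx j))) :
    permute σ A ∈ cornerEvent n d δ (s / 64) := by
  have hm : 1 < n / 2 := by omega
  have hsub : ∀ (z : Fin n → ℝ) (g : Fin (n / 2) → Fin n), (∀ a, 0 ≤ z a) →
      Function.Injective g → ∑ i, z (σ (g i)) ≤ ∑ a, z a := by
    intro z g hz hg
    rw [← Equiv.sum_comp σ z]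
    calc _ = ∑ a ∈ Finset.univ.map ⟨g, hg⟩, z (σ a) := by rw [Finset.sum_map]; rfl
      _ ≤ _ := Finset.sum_le_sum_of_subset_of_nonneg (Finset.subset_univ _) fun a _ _ => hz _
  constructor
  -- Converts `d² ≤ n (δ/1000)²` into the bound `10 · d/2 ≤ δ √m` with `m = n / 2`.
  · have h3 : (n : ℝ) ≤ 4 * (n / 2 : ℕ) := by
      have : n ≤ 4 * (n / 2) := by omega
      exact_mod_cast this
    refine le_s₂_of_bilinear hm (topRight (permute σ A)) (fun j => x (σ (rightIdx j)))
      (fun i => y (σ (topIdx i))) hδ (D := d / 2)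
      (by linarith) hs (by linarith) ?_
      ((hsub (fun a => x a ^ 2) _ (fun a => sq_nonneg _) rightIdx_injective).trans hx)
      ((hsub (fun a => y a ^ 2) _ (fun a => sq_nonneg _) topIdx_injective).trans hy)
      (abs_le_of_sq_le_sq (by linarith) (by norm_num))
      (abs_le_of_sq_le_sq (by linarith) (by norm_num))
      (sum_sq_le_of_expDev_le_one (by omega) hδ hK hu)
      (sum_sq_le_of_expDev_le_one (by omega) hδ hK hv) hZ
    refine le_of_sq_le_sq ?_ (by positivity)
    rw [mul_pow δ, Real.sq_sqrt (by positivity)]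
    nlinarith [mul_le_mul_of_nonneg_right h3 (sq_nonneg δ)]
  · refine mem_Deg_of_expDev_le_one (by omega) (fun i j => hA _ _) hδ (K := K) (by linarith)
      (fun j => ?_) (fun i => ?_) hu hv
    · rw [mul_div_cancel₀ _ (two_ne_zero), ← hcol (σ (rightIdx j))]
      exact hsub (fun a => A a (σ (rightIdx j))) topIdx (fun a => hA _ _) topIdx_injective
    · rw [mul_div_cancel₀ _ (two_ne_zero), ← hrow (σ (topIdx i))]
      exact hsub (fun a => A (σ (topIdx i)) a) rightIdx (fun a => hA _ _) rightIdx_injective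

theorem le_expect_cornerEvent_of_max (hn : 1000 ≤ n) {A : Matrix (Fin n) (Fin n) ℝ}
    {d δ s : ℝ} (hδ : 0 < δ) (hd : 0 < d) (hA : ∀ i j, 0 ≤ A i j) (hrow : ∀ i, ∑ j, A i j = d)
    (hcol : ∀ j, ∑ i, A i j = d) (hrow2 : ∀ i, ∑ j, A i j ^ 2 ≤ (δ / 1000) ^ 2)
    (hcol2 : ∀ j, ∑ i, A i j ^ 2 ≤ (δ / 1000) ^ 2) (hs : 1000 * δ ≤ s)
    {x y : Fin n → ℝ} (hx0 : ∑ j, x j = 0) (hy0 : ∑ i, y i = 0)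
    (hx : ∑ j, x j ^ 2 ≤ 1) (hy : ∑ i, y i ^ 2 ≤ 1)
    (hxy : ∑ i, ∑ j, A i j * y i * x j = s)
    (hmax : ∀ x' y' : Fin n → ℝ, ∑ j, x' j = 0 → ∑ i, y' i = 0 → ∑ j, x' j ^ 2 ≤ 1 →
      ∑ i, y' i ^ 2 ≤ 1 → ∑ i, ∑ j, A i j * y' i * x' j ≤ s) :
    1 / 64 ≤ Finset.expect Finset.univ (fun σ : Equiv.Perm (Fin n) =>
      (cornerEvent n d δ (s / 64)).indicator (fun _ => (1 : ℝ)) (permute σ A)) := by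
  set κ := δ / 1000 with hκ
  have hκ0 : 0 < κ := by positivity
  have hs0 : 0 < s := by linarith
  have hκs : κ ≤ s / 1000000 := by linarith
  have hn0 : (1000 : ℝ) ≤ n := by exact_mod_cast hn
  have hnpos : 0 < n := by omega
  have hsd : s ≤ d := hxy ▸ bilinear_le_of_regular hA hrow hcol hd.le hx hy
  -- Cauchy-Schwarz on one row: a row of sum `d` and small Euclidean norm forces `d` to be at most
  -- `κ √n`.
  have hdn : d ^ 2 ≤ n * κ ^ 2 := by
    have h := sq_sum_le_card_mul_sum_sq (s := Finset.univ) (f := fun j => A ⟨0, hnpos⟩ j)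
    rw [hrow, Finset.card_univ, Fintype.card_fin] at h
    exact h.trans (by gcongr; exact hrow2 _)
  have hdn' : d / n ≤ κ := by
    rw [div_le_iff₀ (by linarith)]
    refine le_of_sq_le_sq (hdn.trans ?_) (by positivity)
    nlinarith [sq_nonneg κ]
  -- Degrees of the corner deviate from `d/2` by at most `d/2`, so levels above `d/δ` need no
  -- control.
  set K := ⌈d / δ⌉₊ with hKdef
  have hK : 1 ≤ K := Nat.one_le_ceil_iff.2 (by positivity)
  have hKd : d ≤ K * δ := (div_le_iff₀ hδ).1 (Nat.le_ceil _)
  set Z : Equiv.Perm (Fin n) → ℝ := fun σ => ∑ i, ∑ j,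
    A (σ (topIdx i)) (σ (rightIdx j)) * y (σ (topIdx i)) * x (σ (rightIdx j)) with hZ
  set X : Equiv.Perm (Fin n) → ℝ := fun σ => (∑ j, x (σ (rightIdx j))) ^ 2 with hX
  set Y : Equiv.Perm (Fin n) → ℝ := fun σ => (∑ i, y (σ (topIdx i))) ^ 2 with hY
  set U : Equiv.Perm (Fin n) → ℝ := fun σ =>
    expDev K δ (fun j => ∑ i, A (σ (topIdx i)) (σ (rightIdx j)) - d / 2) with hU
  set V : Equiv.Perm (Fin n) → ℝ := fun σ =>
    expDev K δ (fun i => ∑ j, A (σ (topIdx i)) (σ (rightIdx j)) - d / 2) with hV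
  -- All requirements in one linear inequality, so that only expectations are needed. If one fails,
  -- the left side is nonpositive: half of each penalty `1/50` absorbs the excess of `Z` over `s`,
  -- and the other half reaches 1 once `X` or `Y` exceeds 100.
  have hpt : ∀ σ, s⁻¹ * Z σ - 1 / 8 - U σ - V σ - 1 / 50 * X σ - 1 / 50 * Y σ ≤
      (cornerEvent n d δ (s / 64)).indicator (fun _ => (1 : ℝ)) (permute σ A) := by
    intro σ
    have hX0 : 0 ≤ X σ := sq_nonneg _
    have hY0 : 0 ≤ Y σ := sq_nonneg _
    have hU0 : 0 ≤ U σ := expDev_nonneg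
    have hV0 : 0 ≤ V σ := expDev_nonneg
    have hZs : s⁻¹ * Z σ ≤ 1 + 1 / 100 * X σ + 1 / 100 * Y σ := by
      rw [inv_mul_le_iff₀ hs0]
      have h1 : Z σ ≤ s + d / n * ((∑ j, x (σ (rightIdx j))) * ∑ i, y (σ (topIdx i))) :=
        bilinear_submatrix_le hnpos hrow hcol hmax hx hy
          (σ.injective.comp topIdx_injective) (σ.injective.comp rightIdx_injective)
      have h2 : (∑ j, x (σ (rightIdx j))) * ∑ i, y (σ (topIdx i)) ≤ X σ + Y σ := by
        simp only [hX, hY]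
        nlinarith [sq_nonneg (∑ j, x (σ (rightIdx j)) - ∑ i, y (σ (topIdx i))),
          sq_nonneg (∑ j, x (σ (rightIdx j))), sq_nonneg (∑ i, y (σ (topIdx i)))]
      have h3 : d / n * ((∑ j, x (σ (rightIdx j))) * ∑ i, y (σ (topIdx i))) ≤
          s / 100 * (X σ + Y σ) := by
        calc _ ≤ d / n * (X σ + Y σ) := by gcongr
          _ ≤ _ := mul_le_mul_of_nonneg_right (by linarith) (by positivity)
      linarith
    by_cases hG : permute σ A ∈ cornerEvent n d δ (s / 64)
    · rw [Set.indicator_of_mem hG]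
      linarith
    · rw [Set.indicator_of_notMem hG]
      by_contra! hlt
      refine hG (topRight_permute_mem_of_bounds hn hδ hA hrow hcol hdn hs hsd hx hy hK hKd
        σ ?_ ?_ ?_ ?_ ?_)
      · change X σ ≤ 100
        linarith
      · change Y σ ≤ 100
        linarith
      · change U σ ≤ 1
        linarith
      · change V σ ≤ 1
        linarith
      · change s / 8 ≤ Z σ
        have h1 : 1 / 8 ≤ s⁻¹ * Z σ := by linarith
        rw [le_inv_mul_iff₀ hs0] at h1
        linarith
  refine le_trans ?_ (Finset.expect_le_expect fun σ _ => hpt σ)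
  simp only [Finset.expect_sub_distrib, ← Finset.mul_expect]
  rw [Fintype.expect_const]
  have hmn : n / 2 ≤ n := Nat.div_le_self _ _
  have hEX : Finset.expect Finset.univ X ≤ 1 :=
    (expect_sq_sum_perm_le hmn rightIdx_injective x hx0).trans hx
  have hEY : Finset.expect Finset.univ Y ≤ 1 :=
    (expect_sq_sum_perm_le hmn topIdx_injective y hy0).trans hy
  have hEU : Finset.expect Finset.univ U ≤ 1 / 100 :=
    expect_expDev_le hδ _ fun j t => expect_exp_sum_perm_le topIdx_injective rightIdx_injective
      topIdx_ne_rightIdx (by omega) A hA hκ0.le hcol hcol2 j t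
  have hEV : Finset.expect Finset.univ V ≤ 1 / 100 :=
    expect_expDev_le hδ _ fun j t => expect_exp_sum_perm_le rightIdx_injective topIdx_injective
      (fun i j => (topIdx_ne_rightIdx j i).symm) (by omega) (fun a b => A b a) (fun a b => hA b a)
      hκ0.le hrow hrow2 j t
  -- A given off-diagonal entry falls in the corner with probability `m²/(n(n-1)) ≥ 0.24`, where `m
  -- = n / 2`; the diagonal never does, and carries at most `κ ≤ 0.01 s` of the form.
  have hEZ : 0.23 * s ≤ Finset.expect Finset.univ Z := by
    have h1 : Finset.expect Finset.univ Z = _ :=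
      expect_sum_sum_perm (e := topIdx) (f := rightIdx) topIdx_ne_rightIdx
        (fun a b => A a b * y a * x b)
    rw [h1, hxy]
    have h2 : ∑ a, A a a * y a * x a ≤ κ := by
      have hAκ : ∀ a, A a a ≤ κ := fun a => le_of_sq_le_sq
        ((Finset.single_le_sum (f := fun j => A a j ^ 2) (fun j _ => sq_nonneg _)
          (Finset.mem_univ a)).trans (hrow2 a)) hκ0.le
      calc _ ≤ ∑ a, (κ * (y a ^ 2) / 2 + κ * (x a ^ 2) / 2) := by
            refine Finset.sum_le_sum fun a _ => ?_
            have h3 : y a * x a ≤ (y a ^ 2 + x a ^ 2) / 2 := by nlinarith [sq_nonneg (y a - x a)]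
            have h4 : A a a * (y a * x a) ≤ A a a * ((y a ^ 2 + x a ^ 2) / 2) :=
              mul_le_mul_of_nonneg_left h3 (hA a a)
            have h5 : A a a * ((y a ^ 2 + x a ^ 2) / 2) ≤ κ * ((y a ^ 2 + x a ^ 2) / 2) :=
              mul_le_mul_of_nonneg_right (hAκ a) (by positivity)
            linarith
        _ = κ * (∑ a, y a ^ 2) / 2 + κ * (∑ a, x a ^ 2) / 2 := by
            rw [Finset.sum_add_distrib, ← Finset.sum_div, ← Finset.sum_div, ← Finset.mul_sum,
              ← Finset.mul_sum]
        _ ≤ κ * 1 / 2 + κ * 1 / 2 := by gcongr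
        _ = κ := by ring
    have h3 : (n : ℝ) - 1 ≤ 2 * (n / 2 : ℕ) := by
      have : n ≤ 2 * (n / 2) + 1 := by omega
      have : (n : ℝ) ≤ 2 * (n / 2 : ℕ) + 1 := by exact_mod_cast this
      linarith
    have h4 : 0 < (n : ℝ) * (n - 1) := mul_pos (by linarith) (by linarith)
    rw [mul_div_assoc', le_div_iff₀ h4]
    have h5 : (n - 1 : ℝ) * (n - 1) ≤ (2 * (n / 2 : ℕ)) * (2 * (n / 2 : ℕ)) :=
      mul_self_le_mul_self (by linarith) h3
    have h6 : 0.24 * ((n : ℝ) * (n - 1)) ≤ (n / 2 : ℕ) * (n / 2 : ℕ) := by nlinarith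
    calc 0.23 * s * (n * (n - 1)) ≤ 0.24 * (n * (n - 1)) * (0.99 * s) := by
          nlinarith [mul_pos hs0 h4]
      _ ≤ (n / 2 : ℕ) * (n / 2 : ℕ) * (s - ∑ a, A a a * y a * x a) := by
          refine mul_le_mul h6 ?_ (by positivity) (by positivity)
          linarith
  have hEZ' : 0.23 ≤ s⁻¹ * Finset.expect Finset.univ Z := by
    rw [le_inv_mul_iff₀ hs0]
    linarith
  -- The balance is `0.23 - 1/8 - 2/100 - 2/50 = 0.045 > 1/64`.
  norm_num at hEZ' ⊢
  linarith

/-- If a regular matrix has a large second singular value, then so does its corner after a random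
simultaneous permutation of the rows and columns, with probability bounded from below. -/
theorem le_expect_cornerEvent (hn : 1000 ≤ n) {A : Matrix (Fin n) (Fin n) ℝ}
    {d δ L : ℝ} (hδ : 0 < δ) (hd : 0 < d) (hL : 1000 ≤ L) (hA : A ∈ regularClass n d)
    (hnorm : ∀ i, 1000 * ‖WithLp.toLp 2 (A.row i)‖ ≤ δ ∧ 1000 * ‖WithLp.toLp 2 (A.col i)‖ ≤ δ)
    (hs₂ : L * δ ≤ s₂ A) :
    1 / 64 ≤ Finset.expect Finset.univ (fun σ : Equiv.Perm (Fin n) =>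
      (cornerEvent n d δ (1 / 64 * L * δ)).indicator (fun _ => (1 : ℝ)) (permute σ A)) := by
  obtain ⟨hA0, hcolN, hrowN⟩ := hA
  have hrow : ∀ i, ∑ j, A i j = d := fun i => by rw [← rowNorms_eq_sum hA0, hrowN]
  have hcol : ∀ j, ∑ i, A i j = d := fun j => by rw [← colNorms_eq_sum hA0, hcolN]
  have hsq : ∀ w : Fin n → ℝ, 1000 * ‖WithLp.toLp 2 w‖ ≤ δ → ∑ j, w j ^ 2 ≤ (δ / 1000) ^ 2 := by
    intro w hw
    have h1 : ∑ j, w j ^ 2 = ‖WithLp.toLp 2 w‖ ^ 2 := by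
      rw [EuclideanSpace.real_norm_sq_eq]
    rw [h1]
    gcongr
    linarith
  have hLδ : 0 < L * δ := by positivity
  obtain ⟨x, y, hx0, hy0, hx, hy, hmax⟩ := exists_isMax_bilinear A
  obtain ⟨x', y', hx0', hy0', hx', hy', hle⟩ := exists_bilinear_ge_s₂ (by omega) hcol hLδ hs₂
  have hs := hle.trans (hmax x' y' hx0' hy0' hx' hy')
  have h1000 : 1000 * δ ≤ L * δ := by gcongr
  refine (le_expect_cornerEvent_of_max hn hδ hd hA0 hrow hcol (fun i => hsq _ (hnorm i).1)
    (fun j => hsq _ (hnorm j).2) (h1000.trans hs) hx0 hy0 hx hy rfl hmax).trans ?_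
  refine Finset.expect_le_expect fun σ _ => ?_
  have hsub : cornerEvent n d δ ((∑ i, ∑ j, A i j * y i * x j) / 64) ⊆
      cornerEvent n d δ (1 / 64 * L * δ) := fun M hM => ⟨by linarith [hM.1], hM.2⟩
  exact Set.indicator_le_indicator_of_subset hsub (fun _ => zero_le_one) _

end Corner

/-! ### Measurability, and averaging over the permutations. -/

instance instBorelSpaceMatrix {m n : ℕ} : BorelSpace (Matrix (Fin m) (Fin n) ℝ) :=
  inferInstanceAs (BorelSpace (Fin m → Fin n → ℝ))

theorem continuous_topRight {n : ℕ} :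
    Continuous (topRight : Matrix (Fin n) (Fin n) ℝ → _) :=
  continuous_matrix fun _ _ => continuous_id.matrix_elem _ _

theorem measurable_permute {n : ℕ} (σ : Equiv.Perm (Fin n)) : Measurable (permute σ) :=
  Continuous.measurable (continuous_matrix fun _ _ => continuous_id.matrix_elem _ _)

theorem continuous_colNorms {m : ℕ} :
    Continuous (colNorms : Matrix (Fin m) (Fin m) ℝ → Fin m → ℝ) := by
  refine continuous_pi fun j => ?_
  refine continuous_norm.comp ((PiLp.continuous_toLp 1 _).comp ?_)
  exact continuous_pi fun i => continuous_id.matrix_elem i j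

theorem continuous_rowNorms {m : ℕ} :
    Continuous (rowNorms : Matrix (Fin m) (Fin m) ℝ → Fin m → ℝ) := by
  refine continuous_pi fun i => ?_
  refine continuous_norm.comp ((PiLp.continuous_toLp 1 _).comp ?_)
  exact continuous_pi fun j => continuous_id.matrix_elem i j

theorem measurableSet_card_filter_le {m : ℕ} {ι : Type*} [MeasurableSpace ι] {f : ι → Fin m → ℝ}
    (hf : Measurable f) (D a b : ℝ) :
    MeasurableSet {z | ((Finset.univ.filter fun i => a < |f z i - D|).card : ℝ) ≤ b} := by
  simp_rw [Finset.card_filter]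
  push_cast
  refine measurableSet_le (Finset.measurable_sum _ fun i _ => ?_) measurable_const
  refine Measurable.ite (measurableSet_lt measurable_const ?_) measurable_const measurable_const
  exact (((measurable_pi_apply i).comp hf).sub_const D).abs

theorem measurableSet_Deg (m : ℕ) (d δ : ℝ) : MeasurableSet (Deg m d δ) := by
  have hnn : ∀ g : (Fin m → ℝ) × (Fin m → ℝ) → Fin m → ℝ, Measurable g →
      MeasurableSet {p | ∀ i, 0 ≤ g p i} := fun g hg => by
    rw [Set.ofPred_forall]
    exact MeasurableSet.iInter fun i =>
      measurableSet_le measurable_const ((measurable_pi_apply i).comp hg)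
  have hcard : ∀ g : (Fin m → ℝ) × (Fin m → ℝ) → Fin m → ℝ, Measurable g →
      MeasurableSet {p | ∀ k : ℕ, ((Finset.univ.filter fun i => (k : ℝ) * δ < |g p i - d|).card : ℝ)
        ≤ m * Real.exp (-(k : ℝ) ^ 2)} := fun g hg => by
    rw [Set.ofPred_forall]
    exact MeasurableSet.iInter fun k => measurableSet_card_filter_le hg _ _ _
  have hnorm : Continuous fun u : Fin m → ℝ => ‖WithLp.toLp 1 u‖ :=
    continuous_norm.comp (PiLp.continuous_toLp 1 _)
  exact (hnn _ measurable_fst).inter ((hnn _ measurable_snd).inter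
    ((measurableSet_eq_fun (hnorm.measurable.comp measurable_fst)
      (hnorm.measurable.comp measurable_snd)).inter
      ((hcard _ measurable_fst).inter (hcard _ measurable_snd))))

theorem measurableSet_cornerEvent {n : ℕ} (hn : 1 < n / 2) (d δ a : ℝ) :
    MeasurableSet (cornerEvent n d δ a) := by
  refine MeasurableSet.inter ?_ ?_
  · exact measurableSet_le measurable_const
      ((continuous_s₂ hn).comp continuous_topRight).measurable
  · exact (measurableSet_Deg _ _ _).preimage
      ((continuous_colNorms.comp continuous_topRight).prodMk
        (continuous_rowNorms.comp continuous_topRight)).measurable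

/-- Integrate the pointwise bound and exchange integral with average: by exchangeability every
permutation contributes the same probability. -/
theorem measureReal_le_of_expect_indicator {n : ℕ} {Ω : Type*} [MeasurableSpace Ω]
    {P : Measure Ω} [IsProbabilityMeasure P] {A : Ω → Matrix (Fin n) (Fin n) ℝ}
    (hA : Measurable A) (hexch : JointlyExchangeable P A) {H : Set Ω} (hH : MeasurableSet H)
    {G : Set (Matrix (Fin n) (Fin n) ℝ)} (hG : MeasurableSet G) {c : ℝ}
    (h : ∀ᵐ ω ∂P, ω ∈ H → c ≤ Finset.expect Finset.univ (fun σ : Equiv.Perm (Fin n) =>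
      G.indicator (fun _ => (1 : ℝ)) (permute σ (A ω)))) :
    c * P.real H ≤ P.real (A ⁻¹' G) := by
  have hmeas : ∀ σ : Equiv.Perm (Fin n), MeasurableSet ((fun ω => permute σ (A ω)) ⁻¹' G) :=
    fun σ => ((measurable_permute σ).comp hA) hG
  have hind : ∀ σ : Equiv.Perm (Fin n),
      (fun ω => G.indicator (fun _ => (1 : ℝ)) (permute σ (A ω))) =
        ((fun ω => permute σ (A ω)) ⁻¹' G).indicator (fun _ => (1 : ℝ)) := fun σ => rfl
  have hint : ∀ σ : Equiv.Perm (Fin n),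
      Integrable (fun ω => G.indicator (fun _ => (1 : ℝ)) (permute σ (A ω))) P := fun σ => by
    rw [hind]
    exact (integrable_const 1).indicator (hmeas σ)
  have hval : ∀ σ : Equiv.Perm (Fin n),
      ∫ ω, G.indicator (fun _ => (1 : ℝ)) (permute σ (A ω)) ∂P = P.real (A ⁻¹' G) := fun σ => by
    rw [hind, integral_indicator_const _ (hmeas σ), smul_eq_mul, mul_one, Measure.real,
      Measure.real, (hexch σ).measure_mem_eq hG]
  calc c * P.real H = ∫ ω, H.indicator (fun _ => c) ω ∂P := by
        rw [integral_indicator_const _ hH, smul_eq_mul, mul_comm]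
    _ ≤ ∫ ω, Finset.expect Finset.univ (fun σ : Equiv.Perm (Fin n) =>
          G.indicator (fun _ => (1 : ℝ)) (permute σ (A ω))) ∂P := by
        refine integral_mono_ae ((integrable_const c).indicator hH) ?_ ?_
        · simp_rw [Fintype.expect_eq_sum_div_card]
          exact (integrable_finsetSum _ fun σ _ => hint σ).div_const _
        · filter_upwards [h] with ω hω
          by_cases hωH : ω ∈ H
          · simpa [hωH] using hω hωH
          · simp only [hωH, not_false_eq_true, Set.indicator_of_notMem]
            exact Finset.expect_nonneg fun σ _ => Set.indicator_nonneg (fun _ _ => zero_le_one) _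
    _ = Finset.expect Finset.univ (fun _ : Equiv.Perm (Fin n) => P.real (A ⁻¹' G)) := by
        simp_rw [Fintype.expect_eq_sum_div_card]
        rw [integral_div, integral_finsetSum _ fun σ _ => hint σ]
        simp_rw [hval]
    _ = _ := Fintype.expect_const _

end JointExch

theorem theorem2 :
    ∃ c C : ℝ, 0 < c ∧ 0 < C ∧
      ∀ (n : ℕ) (d δ : ℝ), C ≤ (n : ℝ) → 0 < d → 0 < δ →
        C * δ ≤ d / Real.sqrt (Real.log n) →
      ∀ (Ω : Type*) [MeasurableSpace Ω] (P : Measure Ω) [IsProbabilityMeasure P]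
        (A : Ω → Matrix (Fin n) (Fin n) ℝ),
        Measurable A →
        JointExch.JointlyExchangeable P A →
        (∀ᵐ ω ∂P, A ω ∈ JointExch.regularClass n d) →
        (∀ i : Fin n, ∀ᵐ ω ∂P,
          C * ‖WithLp.toLp 2 ((A ω).row i)‖ ≤ δ ∧ C * ‖WithLp.toLp 2 ((A ω).col i)‖ ≤ δ) →
      ∀ L : ℝ, C ≤ L →
        P.real {ω | L * δ ≤ JointExch.s₂ (A ω)} ≤
          1 / c * P.real {ω | c * L * δ ≤ JointExch.s₂ (JointExch.topRight (A ω)) ∧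
            (JointExch.colNorms (JointExch.topRight (A ω)),
              JointExch.rowNorms (JointExch.topRight (A ω))) ∈
                JointExch.Deg (n / 2) (d / 2) δ} := by
  refine ⟨1 / 64, 1000, by norm_num, by norm_num, ?_⟩
  intro n d δ hn hd hδ _ Ω _ P _ A hA hexch hreg hnorm L hL
  have hn' : 1000 ≤ n := by exact_mod_cast hn
  have hH : MeasurableSet {ω | L * δ ≤ JointExch.s₂ (A ω)} :=
    measurableSet_le measurable_const
      ((JointExch.continuous_s₂ (by omega)).measurable.comp hA)
  have h := JointExch.measureReal_le_of_expect_indicator hA hexch hH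
    (JointExch.measurableSet_cornerEvent (n := n) (by omega) d δ (1 / 64 * L * δ)) (c := 1 / 64) (by
      filter_upwards [hreg, ae_all_iff.2 hnorm] with ω h1 h2 h3
      exact JointExch.le_expect_cornerEvent hn' hδ hd hL h1 h2 h3)
  change _ ≤ 1 / (1 / 64) * P.real (A ⁻¹' JointExch.cornerEvent n d δ (1 / 64 * L * δ))
  linarith
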